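/- A composition is a nonempty finite list of positive integers $\alpha=(a_1,\dots,a_k)$, of length $\ell(\alpha)=k$, with reverse $\alpha^*=(a_k,\dots,a_1)$; it is a palindrome if $\alpha^*=\alpha$. For compositions $\alpha=(a_1,\dots,a_k)$ and $\beta=(b_1,\dots,b_m)$ put $\alpha\cdot\beta=(a_1,\dots,a_k,b_1,\dots,b_m)$, $\alpha\odot\beta=(a_1,\dots,a_{k-1},a_k+b_1,b_2,\dots,b_m)$, and $\alpha\circ\beta=\beta^{\odot a_1}\cdot\beta^{\odot a_2}\cdots\beta^{\odot a_k}$, where $\beta^{\odot i}=\beta\odot\cdots\odot\beta$ ($i$ times). We write $\gamma\ge\alpha$ if $\gamma$ is a composition with the same sum as $\alpha$ and every partial sum of $\gamma$ is a partial sum of $\alpha$. Define $$\mathcal H(\alpha)=\sum_{\gamma\ge\alpha}\frac{y^{\ell(\gamma)-1}z^{\ell(\alpha)-\ell(\gamma)}}{(y+z)^{\ell(\alpha)-1}}\sum_{i=1}^{\ell(\gamma)}x_{\gamma_i}\in\mathbb Q(y,z)[x_1,x_2,\dots].$$ A factorization $\alpha=\alpha_1\circ\cdots\circ\alpha_k$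 is nontrivial if no $\alpha_i$ is the composition $(1)$, no two consecutive factors both have length $1$, and no two consecutive factors both have all parts equal to $1$. It is irreducible if it is nontrivial and no $\alpha_i$ has a nontrivial factorization with at least two factors (the composition $(1)$ has the empty irreducible factorization). The composition $\beta$ is a switch of $\alpha$ if $\beta=\beta_1\circ\cdots\circ\beta_k$ with $\beta_i\in\{\alpha_i,\alpha_i^*\}$ for all $i$, where $\alpha=\alpha_1\circ\cdots\circ\alpha_k$ is an irreducible factorization. A caterpillar is a tree for which deleting all leaves produces a path. $\mathrm{Cat}(a_1,\dots,a_k)$ is the tree consisting of a path $v_1,\dots,v_k$ together with $a_i-1$ leaves attached to $v_i$ for each $i$. It is a caterpillar with spine $v_1,\dots,v_k$ when $a_1,a_k\ge2$. For a finite tree $T$ let $S$ range over its subtrees (nonempty connected subgraphs). Let $e(S)$ be the number of edges of $S$, $d(S)$ the number of edges of $T$ with exactly one endpoint in $S$, and $\ell(S)$ the number of edges of $S$ at least one of whose endpoints is a leaf of $S$. The half-generalized degree polynomial (HDP) of $T$ is $\mathbf H_T(y,z)=\sum_S y^{d(S)}z^{e(S)}$, and the subtree polynomial (STP) of $T$ is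 $\mathbf S_T(q,r)=\sum_S q^{e(S)}r^{\ell(S)}$. **Theorem.** 1. If $\beta$ is a switch of the composition $\alpha$, then $\mathcal H(\alpha)=\mathcal H(\beta)$ and $\mathbf H_{\mathrm{Cat}(1\odot\alpha\odot1)}=\mathbf H_{\mathrm{Cat}(1\odot\beta\odot1)}$. 2. If exactly $q$ of the factors in an irreducible factorization of $\alpha$ are not palindromes, then there is a set of at least $2^{q-1}$ compositions, containing $\alpha$, all with the same $\mathcal H$, no two distinct members of which are reverses of each other. Moreover, the graphs $\mathrm{Cat}(1\odot\beta\odot1)$, for $\beta$ in this set, are pairwise non-isomorphic caterpillars with the same HDP and the same STP. 3. Consequently, there exist arbitrarily large finite sets of pairwise non-isomorphic caterpillars all having the same HDP and the same STP. -/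

import Mathlib

namespace HalfGDP

/-! ### Compositions -/

/-- A composition: a nonempty finite list of positive integers. -/
def IsComposition (α : List ℕ) : Prop := α ≠ [] ∧ ∀ a ∈ α, 0 < a

/-- The near-concatenation `(a₁, …, aₖ) ⊙ (b₁, …, bₘ) = (a₁, …, aₖ₋₁, aₖ + b₁, b₂, …, bₘ)`
(of nonempty lists). -/
def nearConcat (α β : List ℕ) : List ℕ :=
  α.dropLast ++ (α.getLastD 0 + β.headD 0) :: β.tail

/-- The near-concatenation power `β^{⊙ n} = β ⊙ ⋯ ⊙ β` (`n` copies, `n ≥ 1`;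
the value at `n = 0` is never used). -/
def nearPow (β : List ℕ) : ℕ → List ℕ
  | 0 => []
  | 1 => β
  | n + 2 => nearConcat β (nearPow β (n + 1))

/-- `(a₁, …, aₖ) ∘ β = β^{⊙ a₁} · β^{⊙ a₂} ⋯ β^{⊙ aₖ}`. -/
def circ (α β : List ℕ) : List ℕ := α.flatMap (nearPow β)

/-- The product `α₁ ∘ α₂ ∘ ⋯ ∘ αₖ`; the composition `1` is the identity of `∘`. -/
def circProd (fs : List (List ℕ)) : List ℕ := fs.foldr circ [1]

/-- `fs = [α₁, …, αₖ]` is a factorization `α = α₁ ∘ ⋯ ∘ αₖ` into compositions. -/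
def IsFactorization (fs : List (List ℕ)) (α : List ℕ) : Prop :=
  (∀ f ∈ fs, IsComposition f) ∧ circProd fs = α

/-- No factor is the composition `1`, no two consecutive factors both have length `1`, and
no two consecutive factors both have all parts equal to `1`. -/
def IsNontrivial (fs : List (List ℕ)) : Prop :=
  (∀ f ∈ fs, f ≠ [1]) ∧
  fs.IsChain (fun f g => ¬ (f.length = 1 ∧ g.length = 1)) ∧
  fs.IsChain (fun f g => ¬ ((∀ a ∈ f, a = 1) ∧ (∀ b ∈ g, b = 1)))

/-- `fs` is an irreducible factorization of `α`: it is nontrivial, and no factor can itself be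
written nontrivially as a product of two or more factors.  (The composition `1` has the empty
irreducible factorization.) -/
def IsIrreducibleFactorization (fs : List (List ℕ)) (α : List ℕ) : Prop :=
  IsFactorization fs α ∧ IsNontrivial fs ∧
  ∀ f ∈ fs, ¬ ∃ gs : List (List ℕ), 2 ≤ gs.length ∧ IsFactorization gs f ∧ IsNontrivial gs

/-- `β` is a switch of `α`: it is obtained by reversing some of the factors in an
irreducible factorization of `α`. -/
def IsSwitch (α β : List ℕ) : Prop :=
  ∃ fs gs : List (List ℕ), IsIrreducibleFactorization fs α ∧
    List.Forall₂ (fun f g => g = f ∨ g = f.reverse) fs gs ∧ β = circProd gs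

/-- The number of non-palindromic members of a list of compositions. -/
def numNonPalindromes (fs : List (List ℕ)) : ℕ :=
  fs.countP (fun f => decide (f.reverse ≠ f))

/-- Every partial sum of `γ` is a partial sum of `α`, and both have the same total. -/
def Coarsens (γ α : List ℕ) : Prop :=
  γ.sum = α.sum ∧ ∀ j : ℕ, ∃ i : ℕ, (γ.take j).sum = (α.take i).sum

open Classical in
/-- The finite set of all compositions `γ ≥ α` coarsening `α`. -/
noncomputable def coarsenings (α : List ℕ) : Finset (List ℕ) :=
  ((Finset.univ : Finset (Composition α.sum)).image Composition.blocks).filter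
    (fun γ => Coarsens γ α)

theorem mem_coarsenings {α γ : List ℕ} :
    γ ∈ coarsenings α ↔ (∀ a ∈ γ, 0 < a) ∧ Coarsens γ α := by
  simp only [coarsenings, Finset.mem_filter, Finset.mem_image, Finset.mem_univ, true_and]
  constructor
  · rintro ⟨⟨c, rfl⟩, h⟩
    exact ⟨fun a ha => c.blocks_pos ha, h⟩
  · rintro ⟨hp, h⟩
    exact ⟨⟨⟨γ, fun {i} hi => hp i hi, h.1⟩, rfl⟩, h⟩

/-- The field `ℚ(y, z)`. -/
abbrev RatYZ : Type := FractionRing (MvPolynomial (Fin 2) ℚ)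

noncomputable def ratY : RatYZ := algebraMap (MvPolynomial (Fin 2) ℚ) RatYZ (MvPolynomial.X 0)

noncomputable def ratZ : RatYZ := algebraMap (MvPolynomial (Fin 2) ℚ) RatYZ (MvPolynomial.X 1)

/-- `H(α) = ∑_{γ ≥ α} y^{ℓ(γ)-1} z^{ℓ(α)-ℓ(γ)} / (y+z)^{ℓ(α)-1} · ∑ᵢ x_{γᵢ}`,
in the variables `x₁, x₂, …` over `ℚ(y, z)`.  All exponents are natural numbers, since
`1 ≤ ℓ(γ) ≤ ℓ(α)`. -/
noncomputable def genH (α : List ℕ) : MvPolynomial ℕ RatYZ :=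
  ∑ γ ∈ coarsenings α,
    MvPolynomial.C (ratY ^ (γ.length - 1) * ratZ ^ (α.length - γ.length)
      / (ratY + ratZ) ^ (α.length - 1)) * (γ.map MvPolynomial.X).sum

/-! ### Polynomial invariants of trees -/

section Graphs

variable {V : Type*}

/-- `e(A)`: the number of edges with both endpoints in `A`. -/
noncomputable def numInner (G : SimpleGraph V) (A : Finset V) : ℕ :=
  {e ∈ G.edgeSet | ∀ v ∈ e, v ∈ A}.ncard

/-- `d(A)`: the number of edges with exactly one endpoint in `A`. -/
noncomputable def numBoundary (G : SimpleGraph V) (A : Finset V) : ℕ :=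
  {e ∈ G.edgeSet | (∃ v ∈ e, v ∈ A) ∧ ∃ v ∈ e, v ∉ A}.ncard

/-- `ℓ(A)`: the number of edges of the induced subgraph `G|_A` having at least one endpoint
that is a leaf (a vertex of degree one) of `G|_A`. -/
noncomputable def numLeafEdges (G : SimpleGraph V) (A : Finset V) : ℕ :=
  {e ∈ G.edgeSet | (∀ v ∈ e, v ∈ A) ∧ ∃ v ∈ e, {w : V | w ∈ A ∧ G.Adj v w}.ncard = 1}.ncard

open Classical in
/-- The nonempty vertex sets inducing a connected subgraph.  In a tree, `S ↦ V(S)` is a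
bijection from the subtrees to these sets, with inverse `A ↦ G|_A`. -/
noncomputable def subtreeSets [Fintype V] (G : SimpleGraph V) : Finset (Finset V) :=
  Finset.univ.filter (fun A => A.Nonempty ∧ (G.induce (A : Set V)).Connected)

/-- The half-generalized degree polynomial `∑_S y^{d(S)} z^{e(S)}` (`y = X 0`, `z = X 1`). -/
noncomputable def hdp [Fintype V] (G : SimpleGraph V) : MvPolynomial (Fin 2) ℤ :=
  ∑ A ∈ subtreeSets G, MvPolynomial.X 0 ^ numBoundary G A * MvPolynomial.X 1 ^ numInner G A

/-- The subtree polynomial `∑_S q^{e(S)} r^{ℓ(S)}` (`q = X 0`, `r = X 1`). -/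
noncomputable def stp [Fintype V] (G : SimpleGraph V) : MvPolynomial (Fin 2) ℤ :=
  ∑ A ∈ subtreeSets G, MvPolynomial.X 0 ^ numInner G A * MvPolynomial.X 1 ^ numLeafEdges G A

/-- A caterpillar: a tree such that deleting all its leaves produces a path. -/
def IsCaterpillar (G : SimpleGraph V) : Prop :=
  G.IsTree ∧ ∃ k : ℕ,
    Nonempty (G.induce {v | (G.neighborSet v).ncard ≠ 1} ≃g SimpleGraph.pathGraph k)

end Graphs

/-! ### The caterpillar of a composition -/

/-- The vertices of `Cat(a₁, …, aₖ)`: the pair `(i, 0)` is the `i`-th spine vertex, and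
`(i, 1), …, (i, aᵢ - 1)` are the leaves attached to it. -/
abbrev CatVertex (α : List ℕ) : Type := (i : Fin α.length) × Fin (α.get i)

/-- `Cat(α)`: consecutive spine vertices are adjacent, and every leaf is adjacent to its
spine vertex. -/
def Cat (α : List ℕ) : SimpleGraph (CatVertex α) :=
  SimpleGraph.fromRel fun u v =>
    ((u.2 : ℕ) = 0 ∧ (v.2 : ℕ) = 0 ∧ (u.1 : ℕ) + 1 = v.1) ∨
    (u.1 = v.1 ∧ (u.2 : ℕ) = 0 ∧ (v.2 : ℕ) ≠ 0)

/-- `α` is the signature of a caterpillar: a composition whose first and last parts are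
larger than `1`. -/
def IsSignature (α : List ℕ) : Prop :=
  IsComposition α ∧ 1 < α.headD 0 ∧ 1 < α.getLastD 0

/-- `1 ⊙ α ⊙ 1`. -/
def pad (α : List ℕ) : List ℕ := nearConcat (nearConcat [1] α) [1]

end HalfGDP

open HalfGDP

namespace HalfGDP

/-! ### Algebra of compositions -/

/-! Everything rests on the functional P_f(α) = ∑_{γ ≥ α} z^{ℓ(α)-ℓ(γ)} ∏ f(γ_i) (`coarseProd`). It
satisfies P_f(α·β) = P_f(α) P_f(β) + z P_f(α ⊙ β), and in a commutative ring it does not see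
reversal. Since ∘ β respects both · and ⊙, P_f(α ∘ β) = P_{f'}(α) with f'(n) = P_f(β^{⊙n})
(`coarseProd_circ`). Reversing α under the weights belonging to β* therefore gives P(α ∘ β*) = P(α*
∘ β*) = P((α ∘ β)*) = P(α ∘ β). An invariant of this kind is unchanged when any subset of the
factors of a product is reversed (`SwitchFactors.apply_circ_eq`).

The sums ∑ g(γ_i) needed for 𝓗 are a first-order version of these products: over the dual numbers,
with f(n) = y + ε y g(n), the ε-part of P_f is y times the weighted sum `coarseSum`. Taking g(n) =
x_n gives 𝓗. Taking g(n) = (y+z)^{n+1} gives, up to the factor (y+z)^{ℓ(α)-1}, the part of the HDP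
of Cat(1 ⊙ α ⊙ 1) coming from subtrees that meet the spine (`coarseSum_eq_initialSum_pad`); the
single-leaf subtrees depend only on sum and length.

For a tree, the HDP determines the STP. At y = 1 + q(r-1), z = q, expanding the powers of y amounts
to attaching a set L of outside neighbours to a subtree A. Regrouping by A ∪ L, where L becomes a
set of leaves, gives q^e r^ℓ, except that a single edge contributes an extra q(r-1) (`sum_stp_eq`).
The number of edges is itself read off the HDP.

For the count, f ∘ X begins with X up to an enlargement of its last part, so X, and then f, can be
recovered once the sum of X is known. Different choices of reversed factors thus give different
products. Freezing the first non-palindromic factor leaves at least 2^{q-1} products, no two of them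
mutual reverses. Finally, padding makes every spine vertex a non-leaf, so an isomorphism of
caterpillars restricts to an isomorphism of paths and the compositions agree up to reversal. -/

theorem IsComposition.reverse {α : List ℕ} (h : IsComposition α) : IsComposition α.reverse :=
  ⟨by simpa using h.1, fun a ha => h.2 a (by simpa using ha)⟩

theorem isComposition_singleton_one : IsComposition [1] := ⟨by simp, by simp⟩

theorem nearConcat_append_singleton_cons (l m : List ℕ) (a b : ℕ) :
    nearConcat (l ++ [a]) (b :: m) = l ++ (a + b) :: m := by
  simp [nearConcat]

theorem nearConcat_singleton_cons (m : List ℕ) (a b : ℕ) :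
    nearConcat [a] (b :: m) = (a + b) :: m := by
  simp [nearConcat]

theorem nearConcat_ne_nil (α β : List ℕ) : nearConcat α β ≠ [] := by
  simp [nearConcat]

theorem nearConcat_append_left {β : List ℕ} (hβ : β ≠ []) (α γ : List ℕ) :
    nearConcat (α ++ β) γ = α ++ nearConcat β γ := by
  obtain ⟨l, b, rfl⟩ := List.eq_nil_or_concat' β |>.resolve_left hβ
  rw [← List.append_assoc]
  simp [nearConcat]

theorem nearConcat_append_right {β : List ℕ} (hβ : β ≠ []) (α γ : List ℕ) :
    nearConcat α (β ++ γ) = nearConcat α β ++ γ := by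
  cases β with
  | nil => simp at hβ
  | cons b l => simp [nearConcat]

theorem nearConcat_cons_cons (a b : ℕ) (l γ : List ℕ) :
    nearConcat (a :: b :: l) γ = a :: nearConcat (b :: l) γ :=
  nearConcat_append_left (β := b :: l) (by simp) [a] γ

theorem nearConcat_assoc {α β γ : List ℕ} (hα : α ≠ []) (hβ : β ≠ []) (hγ : γ ≠ []) :
    nearConcat (nearConcat α β) γ = nearConcat α (nearConcat β γ) := by
  obtain ⟨l, a, rfl⟩ := List.eq_nil_or_concat' α |>.resolve_left hα
  obtain ⟨c, n, rfl⟩ := List.exists_cons_of_ne_nil hγ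
  obtain ⟨b, m, rfl⟩ := List.exists_cons_of_ne_nil hβ
  rcases List.eq_nil_or_concat' m with rfl | ⟨m, b', rfl⟩
  · rw [nearConcat_append_singleton_cons, nearConcat_append_singleton_cons,
      nearConcat_singleton_cons, nearConcat_append_singleton_cons, add_assoc]
  · rw [nearConcat_append_singleton_cons, ← List.cons_append, ← List.cons_append,
      ← List.append_assoc, nearConcat_append_singleton_cons, nearConcat_append_singleton_cons,
      List.cons_append, nearConcat_append_singleton_cons]
    simp

theorem nearConcat_reverse {α β : List ℕ} (hα : α ≠ []) (hβ : β ≠ []) :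
    (nearConcat α β).reverse = nearConcat β.reverse α.reverse := by
  obtain ⟨l, a, rfl⟩ := List.eq_nil_or_concat' α |>.resolve_left hα
  obtain ⟨b, m, rfl⟩ := List.exists_cons_of_ne_nil hβ
  simp [nearConcat_append_singleton_cons, add_comm]

theorem sum_nearConcat {α β : List ℕ} (hα : α ≠ []) (hβ : β ≠ []) :
    (nearConcat α β).sum = α.sum + β.sum := by
  obtain ⟨l, a, rfl⟩ := List.eq_nil_or_concat' α |>.resolve_left hα
  obtain ⟨b, m, rfl⟩ := List.exists_cons_of_ne_nil hβ
  simp [nearConcat_append_singleton_cons]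
  ring

theorem length_nearConcat {α β : List ℕ} (hα : α ≠ []) (hβ : β ≠ []) :
    (nearConcat α β).length + 1 = α.length + β.length := by
  obtain ⟨l, a, rfl⟩ := List.eq_nil_or_concat' α |>.resolve_left hα
  obtain ⟨b, m, rfl⟩ := List.exists_cons_of_ne_nil hβ
  simp [nearConcat_append_singleton_cons]
  ring

theorem IsComposition.nearConcat {α β : List ℕ} (hα : IsComposition α) (hβ : IsComposition β) :
    IsComposition (nearConcat α β) := by
  obtain ⟨hα, pα⟩ := hα
  obtain ⟨hβ, pβ⟩ := hβ
  obtain ⟨l, a, rfl⟩ := List.eq_nil_or_concat' α |>.resolve_left hα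
  obtain ⟨b, m, rfl⟩ := List.exists_cons_of_ne_nil hβ
  rw [nearConcat_append_singleton_cons]
  refine ⟨by simp, fun x hx => ?_⟩
  simp only [List.mem_append, List.mem_cons] at hx pα pβ
  rcases hx with hx | rfl | hx
  · exact pα _ (by simp [hx])
  · have := pα a (by simp); omega
  · exact pβ _ (by simp [hx])

theorem nearPow_add_two (β : List ℕ) (n : ℕ) :
    nearPow β (n + 2) = nearConcat β (nearPow β (n + 1)) := rfl

theorem nearPow_succ_ne_nil {β : List ℕ} (hβ : β ≠ []) (n : ℕ) : nearPow β (n + 1) ≠ [] := by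
  cases n with
  | zero => exact hβ
  | succ n => exact nearConcat_ne_nil _ _

theorem nearPow_ne_nil {β : List ℕ} (hβ : β ≠ []) {n : ℕ} (hn : 0 < n) : nearPow β n ≠ [] := by
  obtain ⟨n, rfl⟩ := Nat.exists_eq_succ_of_ne_zero hn.ne'
  exact nearPow_succ_ne_nil hβ n

theorem nearPow_add {β : List ℕ} (hβ : β ≠ []) (m : ℕ) {n : ℕ} (hn : 0 < n) :
    nearPow β (m + 1 + n) = nearConcat (nearPow β (m + 1)) (nearPow β n) := by
  obtain ⟨n, rfl⟩ := Nat.exists_eq_succ_of_ne_zero hn.ne'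
  induction m with
  | zero => rw [show 0 + 1 + n.succ = n + 2 by omega]; rfl
  | succ m ih =>
    rw [show m + 1 + 1 + n.succ = (m + 1 + n) + 2 by omega, nearPow_add_two, nearPow_add_two,
      show m + 1 + n + 1 = m + 1 + n.succ by omega, ih,
      nearConcat_assoc hβ (nearPow_succ_ne_nil hβ m) (nearPow_succ_ne_nil hβ n)]

theorem nearPow_add_of_pos {β : List ℕ} (hβ : β ≠ []) {m n : ℕ} (hm : 0 < m) (hn : 0 < n) :
    nearPow β (m + n) = nearConcat (nearPow β m) (nearPow β n) := by
  obtain ⟨m, rfl⟩ := Nat.exists_eq_succ_of_ne_zero hm.ne'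
  exact nearPow_add hβ m hn

theorem nearPow_reverse {β : List ℕ} (hβ : β ≠ []) (n : ℕ) :
    (nearPow β n).reverse = nearPow β.reverse n := by
  have hβ' : β.reverse ≠ [] := by simpa using hβ
  induction n with
  | zero => rfl
  | succ n ih =>
    rcases Nat.eq_zero_or_pos n with rfl | hn
    · rfl
    · rw [nearPow_add_of_pos hβ hn one_pos, add_comm n 1, nearPow_add_of_pos hβ' one_pos hn,
        nearConcat_reverse (nearPow_ne_nil hβ hn) (nearPow_ne_nil hβ one_pos), ih]
      rfl

theorem IsComposition.nearPow {β : List ℕ} (hβ : IsComposition β) {n : ℕ} (hn : 0 < n) :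
    IsComposition (nearPow β n) := by
  induction n, hn using Nat.le_induction with
  | base => exact hβ
  | succ n hn ih =>
    rw [nearPow_add_of_pos hβ.1 hn one_pos]
    exact ih.nearConcat hβ

theorem sum_nearPow {β : List ℕ} (hβ : β ≠ []) (n : ℕ) : (nearPow β n).sum = n * β.sum := by
  induction n with
  | zero => simp [nearPow]
  | succ n ih =>
    rcases Nat.eq_zero_or_pos n with rfl | hn
    · simp [nearPow]
    · rw [nearPow_add_of_pos hβ hn one_pos,
        sum_nearConcat (nearPow_ne_nil hβ hn) (nearPow_ne_nil hβ one_pos), ih]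
      simp [nearPow]; ring

theorem length_nearPow_eq {β β' : List ℕ} (hβ : β ≠ []) (hβ' : β' ≠ [])
    (h : β.length = β'.length) (n : ℕ) : (nearPow β n).length = (nearPow β' n).length := by
  induction n with
  | zero => rfl
  | succ n ih =>
    rcases Nat.eq_zero_or_pos n with rfl | hn
    · exact h
    · rw [nearPow_add_of_pos hβ hn one_pos, nearPow_add_of_pos hβ' hn one_pos]
      have h1 := length_nearConcat (nearPow_ne_nil hβ hn) (nearPow_ne_nil hβ one_pos)
      have h2 := length_nearConcat (nearPow_ne_nil hβ' hn) (nearPow_ne_nil hβ' one_pos)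
      simp only [nearPow] at h1 h2 ⊢
      omega

theorem circ_cons (a : ℕ) (α β : List ℕ) : circ (a :: α) β = nearPow β a ++ circ α β := by
  simp [circ]

theorem circ_singleton (a : ℕ) (β : List ℕ) : circ [a] β = nearPow β a := by
  simp [circ]

theorem circ_append (α α' β : List ℕ) : circ (α ++ α') β = circ α β ++ circ α' β := by
  simp [circ]

theorem circ_ne_nil {α β : List ℕ} (hα : IsComposition α) (hβ : β ≠ []) : circ α β ≠ [] := by
  obtain ⟨a, l, rfl⟩ := List.exists_cons_of_ne_nil hα.1
  rw [circ_cons]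
  exact List.append_ne_nil_of_left_ne_nil (nearPow_ne_nil hβ (hα.2 a (by simp))) _

theorem IsComposition.circ {α β : List ℕ} (hα : IsComposition α) (hβ : IsComposition β) :
    IsComposition (circ α β) := by
  refine ⟨circ_ne_nil hα hβ.1, fun x hx => ?_⟩
  obtain ⟨a, ha, hx⟩ := List.mem_flatMap.1 hx
  exact (hβ.nearPow (hα.2 a ha)).2 x hx

/-- Only the junction matters, where β^{⊙(a+b)} = β^{⊙a} ⊙ β^{⊙b}. Together with `circ_append`, this
makes ∘ β a homomorphism for both concatenations; associativity and `coarseProd_circ` follow from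
it. -/
theorem circ_nearConcat {α α' β : List ℕ} (hα : IsComposition α) (hα' : IsComposition α')
    (hβ : β ≠ []) : circ (nearConcat α α') β = nearConcat (circ α β) (circ α' β) := by
  obtain ⟨hα, pα⟩ := hα
  obtain ⟨hα', pα'⟩ := hα'
  obtain ⟨l, a, rfl⟩ := List.eq_nil_or_concat' α |>.resolve_left hα
  obtain ⟨b, m, rfl⟩ := List.exists_cons_of_ne_nil hα'
  have ha : 0 < a := pα a (by simp)
  have hb : 0 < b := pα' b (by simp)
  rw [nearConcat_append_singleton_cons, circ_append, circ_append, circ_singleton, circ_cons,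
    circ_cons b, nearConcat_append_left (nearPow_ne_nil hβ ha),
    nearConcat_append_right (nearPow_ne_nil hβ hb), nearPow_add_of_pos hβ ha hb]

theorem nearPow_circ {β γ : List ℕ} (hβ : IsComposition β) (hγ : γ ≠ []) (n : ℕ) :
    nearPow (circ β γ) n = circ (nearPow β n) γ := by
  induction n with
  | zero => rfl
  | succ n ih =>
    rcases Nat.eq_zero_or_pos n with rfl | hn
    · rfl
    · rw [nearPow_add_of_pos (circ_ne_nil hβ hγ) hn one_pos, nearPow_add_of_pos hβ.1 hn one_pos,
        circ_nearConcat (hβ.nearPow hn) (hβ.nearPow one_pos) hγ, ih]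
      rfl

theorem circ_assoc (α : List ℕ) {β γ : List ℕ} (hβ : IsComposition β) (hγ : γ ≠ []) :
    circ (circ α β) γ = circ α (circ β γ) := by
  induction α with
  | nil => rfl
  | cons a l ih => rw [circ_cons, circ_append, circ_cons, ih, nearPow_circ hβ hγ]

theorem circ_reverse (α : List ℕ) {β : List ℕ} (hβ : β ≠ []) :
    (circ α β).reverse = circ α.reverse β.reverse := by
  induction α with
  | nil => rfl
  | cons a l ih =>
    rw [circ_cons, List.reverse_append, ih, List.reverse_cons, circ_append, circ_singleton,
      nearPow_reverse hβ]

theorem one_circ (β : List ℕ) : circ [1] β = β := by simp [circ, nearPow]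

theorem sum_circ (α : List ℕ) {β : List ℕ} (hβ : β ≠ []) :
    (circ α β).sum = α.sum * β.sum := by
  induction α with
  | nil => simp [circ]
  | cons a l ih => rw [circ_cons, List.sum_append, ih, sum_nearPow hβ, List.sum_cons, add_mul]

theorem length_circ_reverse_right (α : List ℕ) {β : List ℕ} (hβ : β ≠ []) :
    (circ α β.reverse).length = (circ α β).length := by
  induction α with
  | nil => rfl
  | cons a l ih =>
    rw [circ_cons, circ_cons, List.length_append, List.length_append, ih,
      length_nearPow_eq (by simpa using hβ) hβ (by simp)]

theorem circProd_cons (f : List ℕ) (fs : List (List ℕ)) :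
    circProd (f :: fs) = circ f (circProd fs) := rfl

theorem isComposition_circProd {fs : List (List ℕ)} (h : ∀ f ∈ fs, IsComposition f) :
    IsComposition (circProd fs) := by
  induction fs with
  | nil => exact isComposition_singleton_one
  | cons f fs ih =>
    exact (h f (by simp)).circ (ih fun g hg => h g (by simp [hg]))

theorem circProd_map_reverse {fs : List (List ℕ)} (h : ∀ f ∈ fs, IsComposition f) :
    circProd (fs.map List.reverse) = (circProd fs).reverse := by
  induction fs with
  | nil => rfl
  | cons f fs ih =>
    have hfs : ∀ f ∈ fs, IsComposition f := fun g hg => h g (by simp [hg])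
    rw [List.map_cons, circProd_cons, ih hfs, circProd_cons,
      circ_reverse _ (isComposition_circProd hfs).1]

/-- The relation between a list of factors and the lists obtained by reversing some of them. -/
abbrev SwitchFactors (fs gs : List (List ℕ)) : Prop :=
  List.Forall₂ (fun f g => g = f ∨ g = f.reverse) fs gs

theorem SwitchFactors.isComposition {fs gs : List (List ℕ)} (h : SwitchFactors fs gs)
    (hfs : ∀ f ∈ fs, IsComposition f) : ∀ g ∈ gs, IsComposition g := by
  induction h with
  | nil => simp
  | @cons f g fs gs hfg _ ih =>
    have hf := hfs f (by simp)
    intro x hx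
    rcases List.mem_cons.1 hx with rfl | hx
    · rcases hfg with rfl | rfl
      exacts [hf, hf.reverse]
    · exact ih (fun f hf => hfs f (by simp [hf])) x hx

/-- A function of compositions that is invariant under reversal and under reversing the right
factor of a product is invariant under reversing any factors. -/
theorem SwitchFactors.apply_circ_eq {M : Type*} (φ : List ℕ → M)
    (hφ : ∀ α β : List ℕ, IsComposition α → IsComposition β →
      φ (circ α β.reverse) = φ (circ α β))
    {fs gs : List (List ℕ)} (h : SwitchFactors fs gs) (hfs : ∀ f ∈ fs, IsComposition f)
    {α : List ℕ} (hα : IsComposition α) :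
    φ (circ α (circProd gs)) = φ (circ α (circProd fs)) := by
  induction h generalizing α with
  | nil => rfl
  | @cons f g fs gs hfg hfgs ih =>
    have hf := hfs f (by simp)
    have hfs' : ∀ f ∈ fs, IsComposition f := fun f hf => hfs f (by simp [hf])
    have hF := isComposition_circProd hfs'
    have hG := isComposition_circProd (SwitchFactors.isComposition hfgs hfs')
    rw [circProd_cons, circProd_cons]
    rcases hfg with rfl | rfl
    · rw [← circ_assoc _ hf hG.1, ← circ_assoc _ hf hF.1, ih hfs' (hα.circ hf)]
    -- Reversing f is two reversals of right factors: α∘f*∘F has the same value as α∘f*∘F* =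
    -- α∘(f∘F)*, hence as α∘(f∘F). The induction hypothesis, with prefix α∘f*, has first replaced
    -- the switched tail by F.
    · rw [← circ_assoc _ hf.reverse hG.1, ih hfs' (hα.circ hf.reverse),
        ← hφ _ _ (hα.circ hf.reverse) hF, circ_assoc _ hf.reverse hF.reverse.1,
        ← circ_reverse _ hF.1, hφ _ _ hα (hf.circ hF)]

theorem SwitchFactors.apply_circProd_eq {M : Type*} (φ : List ℕ → M)
    (hφ : ∀ α β : List ℕ, IsComposition α → IsComposition β →
      φ (circ α β.reverse) = φ (circ α β))
    {fs gs : List (List ℕ)} (h : SwitchFactors fs gs) (hfs : ∀ f ∈ fs, IsComposition f) :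
    φ (circProd gs) = φ (circProd fs) := by
  simpa only [one_circ] using h.apply_circ_eq φ hφ hfs isComposition_singleton_one

/-! ### Weighted sums over coarsenings -/

section CoarseSum

variable {R : Type*} [CommRing R]

/-- `∑_{γ ≥ α} z^{ℓ(α)-ℓ(γ)} ∏ᵢ f(γᵢ)`. -/
def coarseProd (z : R) (f : ℕ → R) : List ℕ → R
  | [] => 1
  | [a] => f a
  | a :: b :: l => f a * coarseProd z f (b :: l) + z * coarseProd z f ((a + b) :: l)
termination_by l => l.length

theorem coarseProd_singleton (z : R) (f : ℕ → R) (a : ℕ) : coarseProd z f [a] = f a := by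
  simp [coarseProd]

theorem coarseProd_cons_cons (z : R) (f : ℕ → R) (a b : ℕ) (l : List ℕ) :
    coarseProd z f (a :: b :: l) =
      f a * coarseProd z f (b :: l) + z * coarseProd z f ((a + b) :: l) := by
  rw [coarseProd]

/-- A coarsening of α·β either cuts at the junction or merges across it. In the second case it
coarsens α ⊙ β, which is one part shorter, hence the extra z. -/
theorem coarseProd_append (z : R) (f : ℕ → R) {α β : List ℕ} (hα : α ≠ []) (hβ : β ≠ []) :
    coarseProd z f (α ++ β) =
      coarseProd z f α * coarseProd z f β + z * coarseProd z f (nearConcat α β) := by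
  obtain ⟨a, l, rfl⟩ := List.exists_cons_of_ne_nil hα
  obtain ⟨c, m, rfl⟩ := List.exists_cons_of_ne_nil hβ
  induction l generalizing a with
  | nil =>
    rw [List.singleton_append, coarseProd_cons_cons, nearConcat_singleton_cons,
      coarseProd_singleton]
  | cons b l ih =>
    rw [List.cons_append, List.cons_append, coarseProd_cons_cons, ← List.cons_append,
      ih b (by simp), ← List.cons_append, ih (a + b) (by simp), coarseProd_cons_cons,
      nearConcat_cons_cons]
    -- Pulling `a` out on the left exposes the recursion of `coarseProd` even when `l` is empty and
    -- the merged first part is also the junction.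
    have : nearConcat ((a + b) :: l) (c :: m) = nearConcat [a] (nearConcat (b :: l) (c :: m)) := by
      rw [← nearConcat_assoc (by simp) (by simp) (by simp), nearConcat_singleton_cons]
    obtain ⟨d, n, hd⟩ := List.exists_cons_of_ne_nil (nearConcat_ne_nil (b :: l) (c :: m))
    rw [this, hd, nearConcat_singleton_cons, coarseProd_cons_cons]
    ring

/-- Coarsening commutes with reversal, and the products commute. Formally, splitting off the last
part of the reversed list reproduces the recursion that splits off the first part. -/
theorem coarseProd_reverse (z : R) (f : ℕ → R) (α : List ℕ) :
    coarseProd z f α.reverse = coarseProd z f α := by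
  induction h : α.length using Nat.strong_induction_on generalizing α with
  | _ n ih =>
    match α with
    | [] => rfl
    | [a] => rfl
    | a :: b :: l =>
      rw [List.reverse_cons, coarseProd_append _ _ (by simp) (by simp),
        show [a] = [a].reverse from rfl, ← nearConcat_reverse (by simp) (by simp),
        nearConcat_singleton_cons, ih _ (by simp [← h]) _ rfl, ih _ (by simp [← h]) ((a + b) :: l) rfl,
        coarseProd_cons_cons, List.reverse_singleton, coarseProd_singleton, mul_comm (f a)]

/-- As functions of α, both sides obey the same cut-or-merge recursion because ∘ β preserves · and
⊙; on a single part a both equal the value at β^{⊙a}. -/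
theorem coarseProd_circ (z : R) (f : ℕ → R) {α β : List ℕ} (hα : IsComposition α)
    (hβ : β ≠ []) :
    coarseProd z f (circ α β) = coarseProd z (fun n => coarseProd z f (nearPow β n)) α := by
  induction h : α.length using Nat.strong_induction_on generalizing α with
  | _ n ih =>
    match α, hα with
    | [], hα => exact absurd rfl hα.1
    | [a], _ => rw [circ_singleton, coarseProd_singleton]
    | a :: b :: l, hα =>
      have ha : IsComposition [a] := ⟨by simp, by simpa using hα.2 a (by simp)⟩
      have hb : IsComposition (b :: l) := ⟨by simp, fun x hx => hα.2 x (List.mem_cons_of_mem _ hx)⟩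
      have hab := ha.nearConcat hb
      rw [← List.singleton_append, circ_append, coarseProd_append _ _ (circ_ne_nil ha hβ)
        (circ_ne_nil hb hβ), ← circ_nearConcat ha hb hβ]
      rw [nearConcat_singleton_cons] at hab ⊢
      rw [ih _ (by simp [← h]) hb rfl, ih _ (by simp [← h]) hab rfl, List.singleton_append,
        coarseProd_cons_cons, circ_singleton]

/-- The central symmetry: α may be reversed freely under the weights coming from β*, and α* ∘ β* is
the reverse of α ∘ β, which is also free. -/
theorem coarseProd_circ_reverse_right (z : R) (f : ℕ → R) (α β : List ℕ) (hα : IsComposition α)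
    (hβ : IsComposition β) :
    coarseProd z f (circ α β.reverse) = coarseProd z f (circ α β) := by
  rw [coarseProd_circ z f hα hβ.reverse.1, ← coarseProd_reverse,
    ← coarseProd_circ z f hα.reverse hβ.reverse.1, ← circ_reverse _ hβ.1, coarseProd_reverse]

/-- `∑_{γ ≥ α} y^{ℓ(γ)-1} z^{ℓ(α)-ℓ(γ)} ∑ᵢ g(γᵢ)`. -/
def coarseSum (y z : R) (g : ℕ → R) : List ℕ → R
  | [] => 0
  | [a] => g a
  | a :: b :: l => y * (g a * (y + z) ^ l.length + coarseSum y z g (b :: l)) +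
      z * coarseSum y z g ((a + b) :: l)
termination_by l => l.length

theorem coarseSum_singleton (y z : R) (g : ℕ → R) (a : ℕ) : coarseSum y z g [a] = g a := by
  simp [coarseSum]

theorem coarseSum_cons_cons (y z : R) (g : ℕ → R) (a b : ℕ) (l : List ℕ) :
    coarseSum y z g (a :: b :: l) = y * (g a * (y + z) ^ l.length + coarseSum y z g (b :: l)) +
      z * coarseSum y z g ((a + b) :: l) := by
  rw [coarseSum]

-- Since ε² = 0, ∏ (y + ε y g(γ_i)) = y^{ℓ(γ)} (1 + ε ∑ g(γ_i)). The ε-free part sums to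
-- y(y+z)^{ℓ(α)-1}, which explains the power of y+z in the recursion of `coarseSum`.
open TrivSqZeroExt in
theorem coarseProd_dualNumber (y z : R) (g : ℕ → R) (a : ℕ) (l : List ℕ) :
    coarseProd (inl z : TrivSqZeroExt R R) (fun n => inl y + inr (y * g n)) (a :: l) =
      inl (y * (y + z) ^ l.length) + inr (y * coarseSum y z g (a :: l)) := by
  induction l generalizing a with
  | nil => simp [coarseProd_singleton, coarseSum_singleton]
  | cons b l ih =>
    rw [coarseProd_cons_cons, ih, ih, coarseSum_cons_cons]
    ext
    · simp; ring
    · simp; ring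

theorem SwitchFactors.coarseSum_eq [IsDomain R] {y z : R} (hy : y ≠ 0) (g : ℕ → R)
    {fs gs : List (List ℕ)} (h : SwitchFactors fs gs) (hfs : ∀ f ∈ fs, IsComposition f) :
    coarseSum y z g (circProd gs) = coarseSum y z g (circProd fs) := by
  have key := h.apply_circProd_eq _ (coarseProd_circ_reverse_right
    (TrivSqZeroExt.inl z : TrivSqZeroExt R R)
    (fun n => TrivSqZeroExt.inl y + TrivSqZeroExt.inr (y * g n))) hfs
  obtain ⟨a, l, hl⟩ := List.exists_cons_of_ne_nil (isComposition_circProd hfs).1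
  obtain ⟨b, m, hm⟩ := List.exists_cons_of_ne_nil
    (isComposition_circProd (h.isComposition hfs)).1
  rw [hl, hm] at key ⊢
  rw [coarseProd_dualNumber, coarseProd_dualNumber] at key
  have := congrArg TrivSqZeroExt.snd key
  simp only [TrivSqZeroExt.snd_add, TrivSqZeroExt.snd_inl, TrivSqZeroExt.snd_inr,
    zero_add] at this
  exact mul_left_cancel₀ hy this

end CoarseSum

theorem SwitchFactors.length_eq {fs gs : List (List ℕ)} (h : SwitchFactors fs gs)
    (hfs : ∀ f ∈ fs, IsComposition f) : (circProd gs).length = (circProd fs).length :=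
  h.apply_circProd_eq _ (fun α _ _ hβ => length_circ_reverse_right α hβ.1) hfs

theorem SwitchFactors.sum_eq {fs gs : List (List ℕ)} (h : SwitchFactors fs gs)
    (hfs : ∀ f ∈ fs, IsComposition f) : (circProd gs).sum = (circProd fs).sum :=
  h.apply_circProd_eq _ (fun α β _ hβ => by
    rw [sum_circ _ hβ.1, sum_circ _ hβ.reverse.1, List.sum_reverse]) hfs

/-! ### Recursion for coarsenings -/

theorem Coarsens.cons {γ α : List ℕ} (a : ℕ) (h : Coarsens γ α) : Coarsens (a :: γ) (a :: α) := by
  refine ⟨by simp [h.1], fun j => ?_⟩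
  cases j with
  | zero => exact ⟨0, by simp⟩
  | succ j =>
    obtain ⟨i, hi⟩ := h.2 j
    exact ⟨i + 1, by simp [hi]⟩

theorem Coarsens.of_cons {γ α : List ℕ} {a : ℕ} (ha : 0 < a) (h : Coarsens (a :: γ) (a :: α)) :
    Coarsens γ α := by
  refine ⟨by simpa using h.1, fun j => ?_⟩
  obtain ⟨i, hi⟩ := h.2 (j + 1)
  cases i with
  | zero => simp at hi; omega
  | succ i => exact ⟨i, by simpa using hi⟩

theorem Coarsens.split_head {γ l : List ℕ} {a b : ℕ} (h : Coarsens γ ((a + b) :: l)) :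
    Coarsens γ (a :: b :: l) := by
  refine ⟨by rw [h.1]; simp [add_assoc], fun j => ?_⟩
  obtain ⟨i, hi⟩ := h.2 j
  cases i with
  | zero => exact ⟨0, by simpa using hi⟩
  | succ i => exact ⟨i + 2, by rw [hi]; simp [add_assoc]⟩

/-- The first part c is a partial sum of (a, b, …), so it is a or at least a+b. In the latter case
no partial sum of the coarsening equals a, and the cut after a can be forgotten. -/
theorem Coarsens.head_eq_or_merge {γ l : List ℕ} {a b c : ℕ} (hb : 0 < b) (hc : 0 < c)
    (h : Coarsens (c :: γ) (a :: b :: l)) : c = a ∨ Coarsens (c :: γ) ((a + b) :: l) := by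
  refine or_iff_not_imp_left.2 fun hca => ⟨by rw [h.1]; simp [add_assoc], fun j => ?_⟩
  cases j with
  | zero => exact ⟨0, by simp⟩
  | succ j =>
    obtain ⟨i, hi⟩ := h.2 (j + 1)
    match i with
    | 0 => simp at hi; omega
    | 1 =>
      obtain ⟨i', hi'⟩ := h.2 1
      match i' with
      | 0 => simp at hi'; omega
      | 1 => simp at hi'; omega
      | i' + 2 => simp at hi hi'; omega
    | i + 2 => exact ⟨i + 1, by rw [hi]; simp [add_assoc]⟩

theorem Coarsens.exists_cons {γ α : List ℕ} (hα : IsComposition α) (h : Coarsens γ α) :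
    ∃ c γ', γ = c :: γ' := by
  refine List.exists_cons_of_ne_nil ?_
  rintro rfl
  obtain ⟨a, l, rfl⟩ := List.exists_cons_of_ne_nil hα.1
  have := hα.2 a (by simp)
  have := h.1
  simp at this
  omega

theorem coarsenings_singleton {a : ℕ} (ha : 0 < a) : coarsenings [a] = {[a]} := by
  ext γ
  rw [mem_coarsenings, Finset.mem_singleton]
  constructor
  · rintro ⟨hp, h⟩
    obtain ⟨c, γ', rfl⟩ := h.exists_cons ⟨by simp, by simpa using ha⟩
    have hc := hp c (by simp)
    have hs := h.1
    obtain ⟨i, hi⟩ := h.2 1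
    have hca : c = a := by
      rcases i with _ | i
      · simp at hi; omega
      · simpa using hi
    subst hca
    cases γ' with
    | nil => rfl
    | cons d l => have := hp d (by simp); simp at hs; omega
  · rintro rfl
    exact ⟨by simpa using ha, rfl, fun j => ⟨j, rfl⟩⟩

theorem coarsenings_cons_cons {a b : ℕ} {l : List ℕ} (h : IsComposition (a :: b :: l)) :
    coarsenings (a :: b :: l) =
      (coarsenings (b :: l)).image (List.cons a) ∪ coarsenings ((a + b) :: l) := by
  have ha := h.2 a (by simp)
  have hb := h.2 b (by simp)
  ext γ
  simp only [Finset.mem_union, Finset.mem_image, mem_coarsenings]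
  constructor
  · rintro ⟨hp, hγ⟩
    obtain ⟨c, γ, rfl⟩ := hγ.exists_cons h
    rcases hγ.head_eq_or_merge hb (hp c (by simp)) with rfl | hm
    · exact Or.inl ⟨γ, ⟨fun x hx => hp x (by simp [hx]), hγ.of_cons ha⟩, rfl⟩
    · exact Or.inr ⟨hp, hm⟩
  · rintro (⟨γ, ⟨hp, hγ⟩, rfl⟩ | ⟨hp, hγ⟩)
    · exact ⟨by simpa [ha] using hp, hγ.cons a⟩
    · exact ⟨hp, hγ.split_head⟩

/-- The two kinds are told apart by whether a is a partial sum; as a and b are positive, it is not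
one of (a+b, …). -/
theorem coarsenings_disjoint {a b : ℕ} {l : List ℕ} (ha : 0 < a) (hb : 0 < b) :
    Disjoint ((coarsenings (b :: l)).image (List.cons a)) (coarsenings ((a + b) :: l)) := by
  rw [Finset.disjoint_left]
  intro γ h1 h2
  obtain ⟨γ, -, rfl⟩ := Finset.mem_image.1 h1
  obtain ⟨i, hi⟩ := (mem_coarsenings.1 h2).2.2 1
  rcases i with _ | i
  · simp at hi; omega
  · simp at hi; omega

theorem sum_coarsenings_cons_cons {M : Type*} [AddCommMonoid M] (F : List ℕ → M) {a b : ℕ}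
    {l : List ℕ} (h : IsComposition (a :: b :: l)) :
    ∑ γ ∈ coarsenings (a :: b :: l), F γ =
      ∑ γ ∈ coarsenings (b :: l), F (a :: γ) + ∑ γ ∈ coarsenings ((a + b) :: l), F γ := by
  rw [coarsenings_cons_cons h,
    Finset.sum_union (coarsenings_disjoint (h.2 a (by simp)) (h.2 b (by simp))),
    Finset.sum_image (by simp)]

theorem IsComposition.tail {a b : ℕ} {l : List ℕ} (h : IsComposition (a :: b :: l)) :
    IsComposition (b :: l) :=
  ⟨by simp, fun x hx => h.2 x (List.mem_cons_of_mem _ hx)⟩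

theorem IsComposition.merge {a b : ℕ} {l : List ℕ} (h : IsComposition (a :: b :: l)) :
    IsComposition ((a + b) :: l) := by
  refine ⟨by simp, fun x hx => ?_⟩
  rcases List.mem_cons.1 hx with rfl | hx
  · have := h.2 a (by simp); omega
  · exact h.2 x (by simp [hx])

theorem length_of_mem_coarsenings {α γ : List ℕ} (hα : IsComposition α)
    (hγ : γ ∈ coarsenings α) : 1 ≤ γ.length ∧ γ.length ≤ α.length := by
  induction h : α.length using Nat.strong_induction_on generalizing α γ with
  | _ n ih =>
    match α, hα with
    | [], hα => exact absurd rfl hα.1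
    | [a], hα =>
      rw [coarsenings_singleton (hα.2 a (by simp)), Finset.mem_singleton] at hγ
      subst hγ
      simp at h ⊢; omega
    | a :: b :: l, hα =>
      rw [coarsenings_cons_cons hα, Finset.mem_union, Finset.mem_image] at hγ
      simp only [List.length_cons] at h
      rcases hγ with ⟨γ, hγ, rfl⟩ | hγ
      · have := ih _ (by simp [← h]) hα.tail hγ rfl
        simp at this ⊢; omega
      · have := ih _ (by simp [← h]) hα.merge hγ rfl
        simp at this ⊢; omega

section CoarseSum

variable {R : Type*} [CommRing R]

/-- Each of the ℓ(α)-1 cuts is independently kept, with weight y, or erased, with weight z. -/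
theorem sum_coarsenings_pow (y z : R) {α : List ℕ} (hα : IsComposition α) :
    ∑ γ ∈ coarsenings α, y ^ (γ.length - 1) * z ^ (α.length - γ.length) =
      (y + z) ^ (α.length - 1) := by
  induction h : α.length using Nat.strong_induction_on generalizing α with
  | _ n ih =>
    match α, hα with
    | [], hα => exact absurd rfl hα.1
    | [a], hα =>
      rw [coarsenings_singleton (hα.2 a (by simp))]
      simp at h
      simp [← h]
    | a :: b :: l, hα =>
      have h1 := ih _ (by simp [← h]) hα.tail rfl
      have h2 := ih _ (by simp [← h]) hα.merge rfl
      simp only [List.length_cons, Nat.add_sub_cancel] at h h1 h2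
      subst h
      rw [sum_coarsenings_cons_cons _ hα]
      have e1 : ∀ γ ∈ coarsenings (b :: l), y ^ ((a :: γ).length - 1) *
          z ^ (l.length + 1 + 1 - (a :: γ).length) =
          y * (y ^ (γ.length - 1) * z ^ (l.length + 1 - γ.length)) := by
        intro γ hγ
        obtain ⟨g1, g2⟩ := length_of_mem_coarsenings hα.tail hγ
        obtain ⟨m, hm⟩ := Nat.exists_eq_add_of_le' g1
        simp only [List.length_cons, hm, Nat.add_sub_cancel, Nat.add_sub_add_right, pow_succ]
        ring
      have e2 : ∀ γ ∈ coarsenings ((a + b) :: l), y ^ (γ.length - 1) *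
          z ^ (l.length + 1 + 1 - γ.length) =
          z * (y ^ (γ.length - 1) * z ^ (l.length + 1 - γ.length)) := by
        intro γ hγ
        obtain ⟨g1, g2⟩ := length_of_mem_coarsenings hα.merge hγ
        rw [List.length_cons] at g2
        rw [Nat.sub_add_comm g2, pow_succ]
        ring
      rw [Finset.sum_congr rfl e1, Finset.sum_congr rfl e2, ← Finset.mul_sum, ← Finset.mul_sum,
        h1, h2, Nat.add_sub_cancel]
      ring

theorem sum_coarsenings_eq_coarseSum (y z : R) (g : ℕ → R) {α : List ℕ} (hα : IsComposition α) :
    ∑ γ ∈ coarsenings α, y ^ (γ.length - 1) * z ^ (α.length - γ.length) * (γ.map g).sum =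
      coarseSum y z g α := by
  induction h : α.length using Nat.strong_induction_on generalizing α with
  | _ n ih =>
    match α, hα with
    | [], hα => exact absurd rfl hα.1
    | [a], hα =>
      rw [coarsenings_singleton (hα.2 a (by simp)), coarseSum_singleton]
      simp at h
      simp [← h]
    | a :: b :: l, hα =>
      have h1 := ih _ (by simp [← h]) hα.tail rfl
      have h2 := ih _ (by simp [← h]) hα.merge rfl
      have h3 := sum_coarsenings_pow y z hα.tail
      simp only [List.length_cons, Nat.add_sub_cancel] at h h1 h2 h3
      subst h
      rw [sum_coarsenings_cons_cons _ hα, coarseSum_cons_cons]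
      have e1 : ∀ γ ∈ coarsenings (b :: l), y ^ ((a :: γ).length - 1) *
          z ^ (l.length + 1 + 1 - (a :: γ).length) * ((a :: γ).map g).sum =
          y * (g a * (y ^ (γ.length - 1) * z ^ (l.length + 1 - γ.length)) +
          (y ^ (γ.length - 1) * z ^ (l.length + 1 - γ.length) * (γ.map g).sum)) := by
        intro γ hγ
        obtain ⟨g1, g2⟩ := length_of_mem_coarsenings hα.tail hγ
        obtain ⟨m, hm⟩ := Nat.exists_eq_add_of_le' g1
        simp only [List.length_cons, hm, Nat.add_sub_cancel, Nat.add_sub_add_right, pow_succ,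
          List.map_cons, List.sum_cons]
        ring
      have e2 : ∀ γ ∈ coarsenings ((a + b) :: l), y ^ (γ.length - 1) *
          z ^ (l.length + 1 + 1 - γ.length) * (γ.map g).sum =
          z * (y ^ (γ.length - 1) * z ^ (l.length + 1 - γ.length) * (γ.map g).sum) := by
        intro γ hγ
        obtain ⟨g1, g2⟩ := length_of_mem_coarsenings hα.merge hγ
        rw [List.length_cons] at g2
        rw [Nat.sub_add_comm g2, pow_succ]
        ring
      rw [Finset.sum_congr rfl e1, Finset.sum_congr rfl e2, ← Finset.mul_sum, ← Finset.mul_sum,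
        Finset.sum_add_distrib, ← Finset.mul_sum, h1, h2, h3]

end CoarseSum

theorem genH_eq_coarseSum {α : List ℕ} (hα : IsComposition α) :
    genH α = MvPolynomial.C ((ratY + ratZ) ^ (α.length - 1))⁻¹ *
      coarseSum (MvPolynomial.C ratY) (MvPolynomial.C ratZ) MvPolynomial.X α := by
  rw [← sum_coarsenings_eq_coarseSum _ _ _ hα, genH, Finset.mul_sum]
  refine Finset.sum_congr rfl fun γ _ => ?_
  rw [div_eq_inv_mul, MvPolynomial.C_mul, MvPolynomial.C_mul, MvPolynomial.C_pow,
    MvPolynomial.C_pow, mul_assoc]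

theorem ratY_ne_zero : ratY ≠ 0 := by
  rw [ratY, Ne, FaithfulSMul.algebraMap_eq_zero_iff]
  exact MvPolynomial.X_ne_zero 0

theorem SwitchFactors.genH_eq {fs gs : List (List ℕ)} (h : SwitchFactors fs gs)
    (hfs : ∀ f ∈ fs, IsComposition f) : genH (circProd gs) = genH (circProd fs) := by
  rw [genH_eq_coarseSum (isComposition_circProd (h.isComposition hfs)),
    genH_eq_coarseSum (isComposition_circProd hfs), h.length_eq hfs,
    h.coarseSum_eq (MvPolynomial.C_ne_zero.2 ratY_ne_zero) _ hfs]

/-! ### Distinctness of the switches -/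

/-- The product starts with a copy of the right factor. Its last part is enlarged exactly when the
first part of f exceeds 1, because the next copy is then glued on. -/
theorem circ_append_singleton_eq {f U : List ℕ} {u : ℕ} (hf : IsComposition f) :
    ∃ v T, u ≤ v ∧ circ f (U ++ [u]) = U ++ v :: T := by
  obtain ⟨a, f, rfl⟩ := List.exists_cons_of_ne_nil hf.1
  have ha := hf.2 a (by simp)
  have hX : U ++ [u] ≠ [] := by simp
  rw [circ_cons]
  match a, ha with
  | 1, _ => exact ⟨u, circ f (U ++ [u]), le_rfl, by simp [nearPow]⟩
  | a + 2, _ =>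
    obtain ⟨w, T, hT⟩ := List.exists_cons_of_ne_nil (nearPow_succ_ne_nil hX a)
    rw [nearPow_add_two, hT, nearConcat_append_singleton_cons]
    exact ⟨u + w, T ++ circ f (U ++ [u]), by omega, by simp⟩

/-- X and Y without their last parts are prefixes of one list. If one prefix were strictly longer,
it would already contain the whole sum of the other composition, leaving nothing for its own
positive last part. -/
theorem circ_right_inj {f g X Y : List ℕ} (hf : IsComposition f) (hg : IsComposition g)
    (hX : IsComposition X) (hY : IsComposition Y) (hs : X.sum = Y.sum)
    (h : circ f X = circ g Y) : X = Y := by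
  obtain ⟨U, u, rfl⟩ := List.eq_nil_or_concat' X |>.resolve_left hX.1
  obtain ⟨W, w, rfl⟩ := List.eq_nil_or_concat' Y |>.resolve_left hY.1
  have hu := hX.2 u (by simp)
  have hw := hY.2 w (by simp)
  obtain ⟨v, T, hv, e⟩ := circ_append_singleton_eq (U := U) (u := u) hf
  obtain ⟨v', T', hv', e'⟩ := circ_append_singleton_eq (U := W) (u := w) hg
  rw [e, e'] at h
  simp only [List.sum_append, List.sum_singleton] at hs
  rcases List.append_eq_append_iff.1 h with ⟨C, hC, hC'⟩ | ⟨C, hC, hC'⟩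
  · cases C with
    | nil => simp at hC; subst hC; rw [show u = w by omega]
    | cons c C => simp at hC'; subst hC; simp at hs; omega
  · cases C with
    | nil => simp at hC; subst hC; rw [show u = w by omega]
    | cons c C => simp at hC'; subst hC; simp at hs; omega

/-- At the position of the last part of X^{⊙a}, the list X^{⊙b} with b > a has a strictly larger
part. -/
theorem nearPow_append_ne {X S T : List ℕ} (hX : IsComposition X) {a b : ℕ} (ha : 0 < a)
    (hab : a < b) : nearPow X a ++ S ≠ nearPow X b ++ T := by
  obtain ⟨d, rfl⟩ := Nat.exists_eq_add_of_lt hab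
  rw [add_assoc, nearPow_add_of_pos hX.1 ha (by omega)]
  obtain ⟨U, u, hU⟩ := List.eq_nil_or_concat' _ |>.resolve_left (nearPow_ne_nil hX.1 ha)
  have hd : IsComposition (nearPow X (d + 1)) := hX.nearPow (by omega)
  obtain ⟨v, V, hV⟩ := List.exists_cons_of_ne_nil hd.1
  have hv : 0 < v := hd.2 v (by simp [hV])
  rw [hU, hV, nearConcat_append_singleton_cons]
  simp
  omega

theorem circ_left_inj {f g X : List ℕ} (hf : ∀ a ∈ f, 0 < a) (hg : ∀ a ∈ g, 0 < a)
    (hX : IsComposition X) (h : circ f X = circ g X) : f = g := by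
  induction f generalizing g with
  | nil =>
    cases g with
    | nil => rfl
    | cons b g => exact absurd h.symm (circ_ne_nil ⟨by simp, hg⟩ hX.1)
  | cons a f ih =>
    cases g with
    | nil => exact absurd h (circ_ne_nil ⟨by simp, hf⟩ hX.1)
    | cons b g =>
      rw [circ_cons, circ_cons] at h
      rcases lt_trichotomy a b with hab | rfl | hab
      · exact absurd h (nearPow_append_ne hX (hf a (by simp)) hab)
      · rw [ih (fun x hx => hf x (by simp [hx])) (fun x hx => hg x (by simp [hx]))
          (List.append_cancel_left h)]
      · exact absurd h.symm (nearPow_append_ne hX (hg b (by simp)) hab)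

/-- Switching preserves sums, so the tail products are equal by `circ_right_inj`; the head is then
cancelled by `circ_left_inj`. -/
theorem circProd_switch_injective {fs gs hs : List (List ℕ)} (hfs : ∀ f ∈ fs, IsComposition f)
    (hg : SwitchFactors fs gs) (hh : SwitchFactors fs hs) (h : circProd gs = circProd hs) :
    gs = hs := by
  induction hg generalizing hs with
  | nil => cases hh; rfl
  | @cons f g fs gs hfg hfgs ih =>
    have hcg := SwitchFactors.isComposition (List.Forall₂.cons hfg hfgs) hfs
    have hch := SwitchFactors.isComposition hh hfs
    have hfs' : ∀ f ∈ fs, IsComposition f := fun f hf => hfs f (by simp [hf])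
    cases hh with
    | @cons _ k _ hs hfk hfhs =>
      have hG := isComposition_circProd fun x hx => hcg x (List.mem_cons_of_mem _ hx)
      have hH := isComposition_circProd fun x hx => hch x (List.mem_cons_of_mem _ hx)
      rw [circProd_cons, circProd_cons] at h
      have e : circProd gs = circProd hs := circ_right_inj (hcg g (by simp)) (hch k (by simp)) hG hH
        (by rw [SwitchFactors.sum_eq hfgs hfs', SwitchFactors.sum_eq hfhs hfs']) h
      rw [e] at h
      rw [ih hfs' hfhs e,
        circ_left_inj (hcg g (by simp)).2 (hch k (by simp)).2 hH h]

/-- All lists obtained from a list of factors by reversing some of them. -/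
def switchings : List (List ℕ) → Finset (List (List ℕ))
  | [] => {[]}
  | f :: fs => (switchings fs).image (List.cons f) ∪ (switchings fs).image (List.cons f.reverse)

/-- The switchings that do not reverse the first non-palindromic factor. -/
def halfSwitchings : List (List ℕ) → Finset (List (List ℕ))
  | [] => {[]}
  | f :: fs => if f.reverse = f then (halfSwitchings fs).image (List.cons f)
      else (switchings fs).image (List.cons f)

theorem switchFactors_of_mem_switchings {fs gs : List (List ℕ)} (h : gs ∈ switchings fs) :
    SwitchFactors fs gs := by
  induction fs generalizing gs with
  | nil => simp [switchings] at h; subst h; exact .nil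
  | cons f fs ih =>
    simp only [switchings, Finset.mem_union, Finset.mem_image] at h
    rcases h with ⟨g, hg, rfl⟩ | ⟨g, hg, rfl⟩
    · exact .cons (.inl rfl) (ih hg)
    · exact .cons (.inr rfl) (ih hg)

theorem self_mem_switchings (fs : List (List ℕ)) : fs ∈ switchings fs := by
  induction fs with
  | nil => simp [switchings]
  | cons f fs ih => simp [switchings, ih]

theorem self_mem_halfSwitchings (fs : List (List ℕ)) : fs ∈ halfSwitchings fs := by
  induction fs with
  | nil => simp [halfSwitchings]
  | cons f fs ih =>
    rw [halfSwitchings]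
    split_ifs
    · exact Finset.mem_image_of_mem _ ih
    · exact Finset.mem_image_of_mem _ (self_mem_switchings fs)

theorem halfSwitchings_subset (fs : List (List ℕ)) : halfSwitchings fs ⊆ switchings fs := by
  induction fs with
  | nil => exact subset_rfl
  | cons f fs ih =>
    rw [halfSwitchings, switchings]
    split_ifs
    · exact (Finset.image_subset_image ih).trans Finset.subset_union_left
    · exact Finset.subset_union_left

theorem card_switchings (fs : List (List ℕ)) :
    (switchings fs).card = 2 ^ numNonPalindromes fs := by
  induction fs with
  | nil => rfl
  | cons f fs ih =>
    have hinj : ∀ g : List ℕ, Function.Injective (List.cons g) := fun g => List.cons_injective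
    rw [switchings, numNonPalindromes, List.countP_cons, ← numNonPalindromes]
    by_cases hf : f.reverse = f
    · simp [hf, Finset.card_image_of_injective _ (hinj f), ih]
    · rw [Finset.card_union_of_disjoint, Finset.card_image_of_injective _ (hinj _),
        Finset.card_image_of_injective _ (hinj _), ih]
      · simp [hf, pow_succ, mul_two]
      · rw [Finset.disjoint_left]
        intro gs h1 h2
        obtain ⟨x, -, rfl⟩ := Finset.mem_image.1 h1
        obtain ⟨y, -, h⟩ := Finset.mem_image.1 h2
        exact hf (List.cons.inj h).1

/-- When there is no non-palindrome, the truncated exponent is 0, matching the single list `fs`. -/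
theorem le_card_halfSwitchings (fs : List (List ℕ)) :
    2 ^ (numNonPalindromes fs - 1) ≤ (halfSwitchings fs).card := by
  induction fs with
  | nil => rfl
  | cons f fs ih =>
    rw [halfSwitchings, numNonPalindromes, List.countP_cons, ← numNonPalindromes]
    by_cases hf : f.reverse = f
    · simpa [hf, Finset.card_image_of_injective _ List.cons_injective] using ih
    · simp [hf, Finset.card_image_of_injective _ List.cons_injective, card_switchings]

/-- Both lists carry the first non-palindromic factor unreversed, so neither is the entrywise
reverse of the other. If all factors are palindromes there is only one list. -/
theorem eq_of_eq_map_reverse {fs gs hs : List (List ℕ)} (hg : gs ∈ halfSwitchings fs)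
    (hh : hs ∈ halfSwitchings fs) (h : gs = hs.map List.reverse) : gs = hs := by
  induction fs generalizing gs hs with
  | nil => simp [halfSwitchings] at hg hh; rw [hg, hh]
  | cons f fs ih =>
    rw [halfSwitchings] at hg hh
    split_ifs at hg hh with hf
    · obtain ⟨g, hg', rfl⟩ := Finset.mem_image.1 hg
      obtain ⟨k, hk', rfl⟩ := Finset.mem_image.1 hh
      rw [ih hg' hk' (List.cons.inj h).2]
    · obtain ⟨g, hg', rfl⟩ := Finset.mem_image.1 hg
      obtain ⟨k, hk', rfl⟩ := Finset.mem_image.1 hh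
      exact absurd (List.cons.inj h).1.symm hf

/-! ### Subtrees of trees -/

section Trees

variable {V : Type*}

/-- Adjacency within a set of vertices. -/
def StepIn (G : SimpleGraph V) (A : Finset V) (x y : V) : Prop := x ∈ A ∧ y ∈ A ∧ G.Adj x y

theorem StepIn.symm {G : SimpleGraph V} {A : Finset V} {x y : V} (h : StepIn G A x y) :
    StepIn G A y x := ⟨h.2.1, h.1, h.2.2.symm⟩

theorem StepIn.reach_symm {G : SimpleGraph V} {A : Finset V} {x y : V}
    (h : Relation.ReflTransGen (StepIn G A) x y) : Relation.ReflTransGen (StepIn G A) y x := by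
  induction h with
  | refl => exact .refl
  | tail _ h ih => exact .head h.symm ih

theorem StepIn.reach_mono {G : SimpleGraph V} {A B : Finset V} (hAB : A ⊆ B) {x y : V}
    (h : Relation.ReflTransGen (StepIn G A) x y) : Relation.ReflTransGen (StepIn G B) x y :=
  h.lift id fun _ _ h => ⟨hAB h.1, hAB h.2.1, h.2.2⟩

theorem mem_subtreeSets [Fintype V] {G : SimpleGraph V} {A : Finset V} :
    A ∈ subtreeSets G ↔ A.Nonempty ∧
      ∀ u ∈ A, ∀ v ∈ A, Relation.ReflTransGen (StepIn G A) u v := by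
  simp only [subtreeSets, Finset.mem_filter, Finset.mem_univ, true_and]
  refine and_congr_right fun hne => ⟨fun h u hu v hv => ?_, fun h => ?_⟩
  · have := h.preconnected ⟨u, hu⟩ ⟨v, hv⟩
    rw [SimpleGraph.reachable_iff_reflTransGen] at this
    exact this.lift Subtype.val fun a b hab => ⟨a.2, b.2, hab⟩
  · have : Nonempty (A : Set V) := hne.to_subtype
    refine ⟨fun u v => ?_⟩
    rw [SimpleGraph.reachable_iff_reflTransGen]
    obtain ⟨u, hu⟩ := u
    obtain ⟨v, hv⟩ := v
    have huv := h u hu v hv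
    clear h
    induction huv with
    | refl => exact .refl
    | tail _ hs ih => exact (ih hs.1).tail hs.2.2

theorem mem_subtreeSets_of_root [Fintype V] {G : SimpleGraph V} {A : Finset V} {u : V}
    (hu : u ∈ A) (h : ∀ v ∈ A, Relation.ReflTransGen (StepIn G A) u v) : A ∈ subtreeSets G :=
  mem_subtreeSets.2 ⟨⟨u, hu⟩, fun x hx y hy => (StepIn.reach_symm (h x hx)).trans (h y hy)⟩

theorem singleton_mem_subtreeSets [Fintype V] (G : SimpleGraph V) (v : V) :
    {v} ∈ subtreeSets G :=
  mem_subtreeSets_of_root (Finset.mem_singleton_self v) fun w hw => by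
    rw [Finset.mem_singleton.1 hw]

theorem connected_of_mem_subtreeSets [Fintype V] {G : SimpleGraph V} {A : Finset V}
    (hA : A ∈ subtreeSets G) : (G.induce (A : Set V)).Connected := by
  simp only [subtreeSets, Finset.mem_filter] at hA
  exact hA.2.2

/-- The unique-attachment property: in an acyclic graph a vertex outside a connected set has at
most one neighbour in it. -/
theorem eq_of_adj_of_notMem [Fintype V] {G : SimpleGraph V} (hG : G.IsAcyclic) {A : Finset V}
    (hA : A ∈ subtreeSets G) {v a b : V} (hv : v ∉ A) (ha : a ∈ A) (hb : b ∈ A)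
    (hva : G.Adj v a) (hvb : G.Adj v b) : a = b := by
  classical
  by_contra hab
  obtain ⟨p⟩ := (connected_of_mem_subtreeSets hA).preconnected ⟨a, ha⟩ ⟨b, hb⟩
  let φ := SimpleGraph.Embedding.induce (G := G) (A : Set V)
  -- One path from a to b stays inside A, the other goes through v; uniqueness of paths in an
  -- acyclic graph would put v in A.
  let q : G.Path a b := p.toPath.map φ.toHom φ.injective
  let w : G.Path a b := ⟨.cons hva.symm (.cons hvb .nil), by
    simp [SimpleGraph.Walk.cons_isPath_iff, hva.ne', hvb.ne, hab]⟩
  have hqw : q = w := (hG.subsingleton_path a b).elim q w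
  have hvq : v ∈ q.1.support := by rw [hqw]; simp [w]
  have hs := SimpleGraph.Walk.support_map φ.toHom p.toPath.1
  have this : v ∈ (p.toPath.1.map φ.toHom).support := hvq
  rw [hs, List.mem_map] at this
  obtain ⟨x, -, rfl⟩ := this
  exact hv x.2

theorem numInner_add_one [Fintype V] {G : SimpleGraph V} (hG : G.IsAcyclic) {A : Finset V}
    (hA : A ∈ subtreeSets G) : numInner G A + 1 = A.card := by
  have htree : (G.induce (A : Set V)).IsTree := ⟨(connected_of_mem_subtreeSets hA), hG.induce _⟩
  have h := (SimpleGraph.isTree_iff_connected_and_card.1 htree).2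
  have e : {e ∈ G.edgeSet | ∀ v ∈ e, v ∈ A} =
      Sym2.map Subtype.val '' (G.induce (A : Set V)).edgeSet := by
    ext e
    induction e with
    | _ x y =>
      simp only [Set.mem_ofPred_eq, SimpleGraph.mem_edgeSet, Sym2.mem_iff, forall_eq_or_imp,
        forall_eq, Set.mem_image]
      constructor
      · rintro ⟨hxy, hx, hy⟩
        exact ⟨s(⟨x, hx⟩, ⟨y, hy⟩), hxy, rfl⟩
      · rintro ⟨e, he, hxy⟩
        induction e with
        | _ u v =>
          rw [Sym2.map_mk, Sym2.eq_iff] at hxy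
          rcases hxy with ⟨rfl, rfl⟩ | ⟨rfl, rfl⟩
          · exact ⟨he, u.2, v.2⟩
          · exact ⟨SimpleGraph.Adj.symm he, v.2, u.2⟩
  rw [numInner, e, Set.ncard_image_of_injective _ (Sym2.map.injective Subtype.val_injective),
    ← Nat.card_coe_set_eq, h]
  simp

open Classical in
/-- The vertices outside `A` adjacent to a vertex of `A`. -/
noncomputable def outer [Fintype V] (G : SimpleGraph V) (A : Finset V) : Finset V :=
  Finset.univ.filter fun v => v ∉ A ∧ ∃ a ∈ A, G.Adj v a

theorem mem_outer [Fintype V] {G : SimpleGraph V} {A : Finset V} {v : V} :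
    v ∈ outer G A ↔ v ∉ A ∧ ∃ a ∈ A, G.Adj v a := by
  simp [outer]

/-- By unique attachment, a boundary edge is determined by its endpoint outside A. -/
theorem numBoundary_eq [Fintype V] {G : SimpleGraph V} (hG : G.IsAcyclic) {A : Finset V}
    (hA : A ∈ subtreeSets G) : numBoundary G A = (outer G A).card := by
  have hex : ∀ v, ∃ a, v ∈ outer G A → a ∈ A ∧ G.Adj v a := fun v => by
    by_cases hv : v ∈ outer G A
    · obtain ⟨a, ha⟩ := (mem_outer.1 hv).2
      exact ⟨a, fun _ => ha⟩
    · exact ⟨v, fun h => absurd h hv⟩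
  choose p hp using hex
  have e : {e ∈ G.edgeSet | (∃ v ∈ e, v ∈ A) ∧ ∃ v ∈ e, v ∉ A} =
      (fun v => s(v, p v)) '' (outer G A : Set V) := by
    ext e
    simp only [Set.mem_ofPred_eq, Set.mem_image, Finset.mem_coe]
    constructor
    · rintro ⟨he, ⟨a, hae, ha⟩, ⟨v, hve, hv⟩⟩
      have hne : v ≠ a := fun h => hv (h ▸ ha)
      have heq : e = s(v, a) := (Sym2.mem_and_mem_iff hne).1 ⟨hve, hae⟩
      subst heq
      have hvo : v ∈ outer G A := mem_outer.2 ⟨hv, a, ha, he⟩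
      exact ⟨v, hvo, by rw [eq_of_adj_of_notMem hG hA hv (hp v hvo).1 ha (hp v hvo).2 he]⟩
    · rintro ⟨v, hv, rfl⟩
      exact ⟨(hp v hv).2, ⟨p v, by simp, (hp v hv).1⟩, v, by simp, (mem_outer.1 hv).1⟩
  rw [numBoundary, e, Set.InjOn.ncard_image, Set.ncard_coe_finset]
  intro v hv w hw hvw
  rcases Sym2.eq_iff.1 hvw with ⟨h, -⟩ | ⟨h, -⟩
  · exact h
  · exact absurd (h ▸ (hp w hw).1) (mem_outer.1 hv).1

theorem hdp_eq_sum_outer [Fintype V] {G : SimpleGraph V} (hG : G.IsAcyclic) :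
    hdp G = ∑ A ∈ subtreeSets G,
      MvPolynomial.X 0 ^ (outer G A).card * MvPolynomial.X 1 ^ (A.card - 1) := by
  refine Finset.sum_congr rfl fun A hA => ?_
  rw [numBoundary_eq hG hA, ← numInner_add_one hG hA, Nat.add_sub_cancel]

open Classical in
/-- The leaves of the subgraph induced on `A`. -/
noncomputable def leavesIn (G : SimpleGraph V) (A : Finset V) : Finset V :=
  A.filter fun v => ∃! w, w ∈ A ∧ G.Adj v w

theorem mem_leavesIn {G : SimpleGraph V} {A : Finset V} {v : V} :
    v ∈ leavesIn G A ↔ v ∈ A ∧ ∃! w, w ∈ A ∧ G.Adj v w := by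
  simp [leavesIn]

theorem ncard_eq_one_iff_existsUnique {p : V → Prop} : {w | p w}.ncard = 1 ↔ ∃! w, p w := by
  rw [Set.ncard_eq_one]
  constructor
  · rintro ⟨a, ha⟩
    exact ⟨a, by simpa using (Set.ext_iff.1 ha a), fun b hb => by simpa using (Set.ext_iff.1 ha b).1 hb⟩
  · rintro ⟨a, ha, hu⟩
    exact ⟨a, Set.ext fun b => ⟨fun hb => hu b hb, fun hb => by rw [hb]; exact ha⟩⟩

/-- Two adjacent leaves have no other neighbours in A, so connectedness makes them all of A. This is
why two-vertex subtrees are exceptional. -/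
theorem not_adj_of_leavesIn [Fintype V] {G : SimpleGraph V} {A : Finset V}
    (hA : A ∈ subtreeSets G) (h3 : 3 ≤ A.card) {v w : V} (hv : v ∈ leavesIn G A)
    (hw : w ∈ leavesIn G A) : ¬ G.Adj v w := by
  classical
  intro hvw
  obtain ⟨hvA, v', hv', huv⟩ := mem_leavesIn.1 hv
  obtain ⟨hwA, w', hw', huw⟩ := mem_leavesIn.1 hw
  have key : ∀ x ∈ A, x = v ∨ x = w := by
    intro x hx
    have hr := (mem_subtreeSets.1 hA).2 v hvA x hx
    clear hx
    induction hr with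
    | refl => exact .inl rfl
    | tail _ hs ih =>
      rcases ih with rfl | rfl
      · exact .inr ((huv _ ⟨hs.2.1, hs.2.2⟩).trans (huv _ ⟨hwA, hvw⟩).symm)
      · exact .inl ((huw _ ⟨hs.2.1, hs.2.2⟩).trans (huw _ ⟨hvA, hvw.symm⟩).symm)
  have : A ⊆ {v, w} := fun x hx => by simpa using key x hx
  have := (Finset.card_le_card this).trans Finset.card_le_two
  omega

theorem numLeafEdges_eq [Fintype V] {G : SimpleGraph V} {A : Finset V}
    (hA : A ∈ subtreeSets G) (h3 : 3 ≤ A.card) : numLeafEdges G A = (leavesIn G A).card := by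
  have hex : ∀ v, ∃ a, v ∈ leavesIn G A → a ∈ A ∧ G.Adj v a := fun v => by
    by_cases hv : v ∈ leavesIn G A
    · obtain ⟨a, ha, -⟩ := (mem_leavesIn.1 hv).2
      exact ⟨a, fun _ => ha⟩
    · exact ⟨v, fun h => absurd h hv⟩
  choose p hp using hex
  have e : {e ∈ G.edgeSet | (∀ v ∈ e, v ∈ A) ∧
      ∃ v ∈ e, {w : V | w ∈ A ∧ G.Adj v w}.ncard = 1} =
      (fun v => s(v, p v)) '' (leavesIn G A : Set V) := by
    ext e
    simp only [Set.mem_ofPred_eq, Set.mem_image, Finset.mem_coe, ncard_eq_one_iff_existsUnique]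
    constructor
    · rintro ⟨he, hall, v, hve, hv⟩
      have hvl : v ∈ leavesIn G A := mem_leavesIn.2 ⟨hall v hve, hv⟩
      obtain ⟨w, rfl⟩ := Sym2.mem_iff_exists.1 hve
      exact ⟨v, hvl, by rw [hv.unique (hp v hvl) ⟨hall w (by simp), he⟩]⟩
    · rintro ⟨v, hv, rfl⟩
      obtain ⟨hvA, hu⟩ := mem_leavesIn.1 hv
      exact ⟨(hp v hv).2, by simp [hvA, (hp v hv).1], v, by simp, hu⟩
  rw [numLeafEdges, e, Set.InjOn.ncard_image, Set.ncard_coe_finset]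
  intro v hv w hw hvw
  rcases Sym2.eq_iff.1 hvw with ⟨h, -⟩ | ⟨h, -⟩
  · exact h
  · exact absurd (h ▸ (hp w hw).2.symm) (not_adj_of_leavesIn hA h3 hv hw)

theorem union_mem_subtreeSets [Fintype V] [DecidableEq V] {G : SimpleGraph V} {A L : Finset V}
    (hA : A ∈ subtreeSets G) (hL : L ⊆ outer G A) : A ∪ L ∈ subtreeSets G := by
  obtain ⟨⟨u, hu⟩, h⟩ := mem_subtreeSets.1 hA
  refine mem_subtreeSets_of_root (Finset.mem_union_left _ hu) fun v hv => ?_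
  rcases Finset.mem_union.1 hv with hv | hv
  · exact StepIn.reach_mono Finset.subset_union_left (h u hu v hv)
  · obtain ⟨-, a, ha, hva⟩ := mem_outer.1 (hL hv)
    exact (StepIn.reach_mono Finset.subset_union_left (h u hu a ha)).tail
      ⟨Finset.mem_union_left _ ha, Finset.mem_union_right _ hv, hva.symm⟩

open Classical in
/-- The sets `L` such that the subtree `A` arises by attaching `L` to the subtree `A \ L`. -/
noncomputable def removable [Fintype V] (G : SimpleGraph V) (A : Finset V) :
    Finset (Finset V) :=
  A.powerset.filter fun L => A \ L ∈ subtreeSets G ∧ L ⊆ outer G (A \ L)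

theorem removable_eq_powerset [Fintype V] {G : SimpleGraph V} (hG : G.IsAcyclic)
    {A : Finset V} (hA : A ∈ subtreeSets G) (h3 : 3 ≤ A.card) :
    removable G A = (leavesIn G A).powerset := by
  classical
  ext L
  simp only [removable, Finset.mem_filter, Finset.mem_powerset]
  constructor
  · rintro ⟨hLA, hc, hL⟩ v hv
    obtain ⟨hvn, a, ha, hva⟩ := mem_outer.1 (hL hv)
    refine mem_leavesIn.2 ⟨hLA hv, a, ⟨Finset.sdiff_subset ha, hva⟩, fun w hw => ?_⟩
    by_cases hwL : w ∈ L
    -- If w is attached as well, (A \ L) ∪ {w} is a subtree containing both neighbours a and w of v;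
    -- unique attachment identifies them.
    · have hB := union_mem_subtreeSets (L := {w}) hc (by simpa using hL hwL)
      refine eq_of_adj_of_notMem hG hB ?_ (by simp) (Finset.mem_union_left _ ha) hw.2 hva
      simp [hv, hw.2.ne]
    · exact eq_of_adj_of_notMem hG hc hvn (Finset.mem_sdiff.2 ⟨hw.1, hwL⟩) ha hw.2 hva
  · intro hL
    have hLA : L ⊆ A := fun v hv => (mem_leavesIn.1 (hL hv)).1
    have hex : ∀ v, ∃ a, v ∈ L → a ∈ A \ L ∧ G.Adj v a ∧ ∀ b ∈ A, G.Adj v b → b = a := fun v => by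
      by_cases hv : v ∈ L
      · obtain ⟨hvA, a, ha, hu⟩ := mem_leavesIn.1 (hL hv)
        refine ⟨a, fun _ => ⟨Finset.mem_sdiff.2 ⟨ha.1, fun haL => ?_⟩, ha.2,
          fun b hb hvb => hu b ⟨hb, hvb⟩⟩⟩
        exact not_adj_of_leavesIn hA h3 (hL hv) (hL haL) ha.2
      · exact ⟨v, fun h => absurd h hv⟩
    choose p hp using hex
    refine ⟨hLA, mem_subtreeSets.2 ⟨?_, ?_⟩, fun v hv => mem_outer.2
      ⟨by simp [hv], p v, (hp v hv).1, (hp v hv).2.1⟩⟩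
    · obtain ⟨x, hx⟩ := (mem_subtreeSets.1 hA).1
      by_cases hxL : x ∈ L
      · exact ⟨p x, (hp x hxL).1⟩
      · exact ⟨x, Finset.mem_sdiff.2 ⟨hx, hxL⟩⟩
    -- The retraction moving each removed leaf to its only neighbour carries walks in A to walks in
    -- A \ L, which is therefore connected.
    · let f : V → V := fun x => if x ∈ L then p x else x
      have hf : ∀ x y, Relation.ReflTransGen (StepIn G A) x y →
          Relation.ReflTransGen (StepIn G (A \ L)) (f x) (f y) := by
        intro x y hxy
        induction hxy with
        | refl => exact .refl
        | @tail y z _ hs ih =>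
          refine ih.trans ?_
          simp only [f]
          by_cases hy : y ∈ L <;> by_cases hz : z ∈ L
          · have := (hp y hy).2.2 z hs.2.1 hs.2.2
            exact absurd (this ▸ hz) (Finset.mem_sdiff.1 (hp y hy).1).2
          · rw [if_pos hy, if_neg hz, (hp y hy).2.2 z hs.2.1 hs.2.2]
          · rw [if_neg hy, if_pos hz, (hp z hz).2.2 y hs.1 hs.2.2.symm]
          · rw [if_neg hy, if_neg hz]
            exact .single ⟨Finset.mem_sdiff.2 ⟨hs.1, hy⟩, Finset.mem_sdiff.2 ⟨hs.2.1, hz⟩, hs.2.2⟩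
      intro u hu v hv
      obtain ⟨hu, huL⟩ := Finset.mem_sdiff.1 hu
      obtain ⟨hv, hvL⟩ := Finset.mem_sdiff.1 hv
      have := hf u v ((mem_subtreeSets.1 hA).2 u hu v hv)
      simpa only [f, if_neg huL, if_neg hvL] using this

theorem adj_of_pair_mem_subtreeSets [Fintype V] [DecidableEq V] {G : SimpleGraph V} {u v : V}
    (huv : u ≠ v) (h : {u, v} ∈ subtreeSets G) : G.Adj u v := by
  have hr := (mem_subtreeSets.1 h).2 u (by simp) v (by simp)
  rcases Relation.ReflTransGen.cases_head hr with h | ⟨w, hs, -⟩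
  · exact absurd h huv
  · have hw := hs.2.1
    rw [Finset.mem_insert, Finset.mem_singleton] at hw
    rcases hw with rfl | rfl
    · exact absurd rfl hs.2.2.ne
    · exact hs.2.2

/-- With at least three vertices, the binomial theorem over sets of leaves gives r to the number of
leaves. For a single edge only ∅ and the two singletons are removable, and 1 + 2(r-1) = r + (r-1).
-/
theorem sum_removable [Fintype V] {G : SimpleGraph V} (hG : G.IsAcyclic) {R : Type*}
    [CommRing R] (r : R) {A : Finset V} (hA : A ∈ subtreeSets G) :
    ∑ L ∈ removable G A, (r - 1) ^ L.card =
      r ^ numLeafEdges G A + if A.card = 2 then r - 1 else 0 := by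
  classical
  rcases (show A.card = 1 ∨ A.card = 2 ∨ 3 ≤ A.card by
    have := (mem_subtreeSets.1 hA).1.card_pos; omega) with h1 | h2 | h3
  · have hin := numInner_add_one hG hA
    have hl : numLeafEdges G A = 0 := by
      refine Nat.eq_zero_of_le_zero ((Set.ncard_le_ncard ?_ (Set.toFinite _)).trans
        (show numInner G A ≤ 0 by omega))
      exact fun e he => ⟨he.1, he.2.1⟩
    have hr : removable G A = {∅} := by
      obtain ⟨u, rfl⟩ := Finset.card_eq_one.1 h1
      ext L
      simp only [removable, Finset.mem_filter, Finset.mem_powerset, Finset.subset_singleton_iff,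
        Finset.mem_singleton]
      constructor
      · rintro ⟨rfl | rfl, h, -⟩
        · rfl
        · simpa using (mem_subtreeSets.1 h).1
      · rintro rfl
        simpa using hA
    rw [hr, hl, h1]
    simp
  · have hin := numInner_add_one hG hA
    obtain ⟨u, v, huv, rfl⟩ := Finset.card_eq_two.1 h2
    have hadj := adj_of_pair_mem_subtreeSets huv hA
    have hl : numLeafEdges G {u, v} = 1 := by
      refine le_antisymm ((Set.ncard_le_ncard ?_ (Set.toFinite _)).trans
        (show numInner G {u, v} ≤ 1 by omega)) ?_
      · exact fun e he => ⟨he.1, he.2.1⟩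
      · rw [Nat.one_le_iff_ne_zero, numLeafEdges, Ne, Set.ncard_eq_zero (Set.toFinite _)]
        refine Set.Nonempty.ne_empty ⟨s(u, v), hadj, by simp, u, by simp, ?_⟩
        rw [ncard_eq_one_iff_existsUnique]
        refine ⟨v, ⟨by simp, hadj⟩, ?_⟩
        rintro w ⟨hw, huw⟩
        rcases (by simpa using hw : w = u ∨ w = v) with rfl | rfl
        · exact absurd rfl huw.ne
        · rfl
    have hr : removable G {u, v} = {∅, {u}, {v}} := by
      ext L
      simp only [removable, Finset.mem_filter, Finset.mem_powerset, Finset.mem_insert,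
        Finset.mem_singleton]
      constructor
      · rintro ⟨hL, h, -⟩
        rw [← Finset.coe_subset, Finset.coe_pair, Set.subset_pair_iff_eq] at hL
        simp only [Finset.coe_eq_empty, Finset.coe_eq_singleton, ← Finset.coe_pair,
          Finset.coe_inj] at hL
        rcases hL with rfl | rfl | rfl | rfl
        · simp
        · simp
        · simp
        · simpa using (mem_subtreeSets.1 h).1
      · have e1 : ({u, v} : Finset V) \ {u} = {v} := by
          ext x; simp only [Finset.mem_sdiff, Finset.mem_insert, Finset.mem_singleton]
          constructor
          · tauto
          · rintro rfl; exact ⟨.inr rfl, huv.symm⟩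
        have e2 : ({u, v} : Finset V) \ {v} = {u} := by
          ext x; simp only [Finset.mem_sdiff, Finset.mem_insert, Finset.mem_singleton]
          constructor
          · tauto
          · rintro rfl; exact ⟨.inl rfl, huv⟩
        rintro (rfl | rfl | rfl)
        · simpa using hA
        · rw [e1]
          refine ⟨by simp, singleton_mem_subtreeSets G v, ?_⟩
          simpa [mem_outer, hadj] using huv
        · rw [e2]
          refine ⟨by simp, singleton_mem_subtreeSets G u, ?_⟩
          simpa [mem_outer, hadj.symm] using huv.symm
    rw [hr, hl, h2, Finset.sum_insert, Finset.sum_insert]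
    · simp only [Finset.card_empty, pow_zero, Finset.card_singleton, pow_one,
        Finset.sum_singleton, if_true]
      ring
    · simpa using huv
    · simp
  · rw [removable_eq_powerset hG hA h3, numLeafEdges_eq hA h3, if_neg (by omega), add_zero]
    have := Finset.sum_pow_mul_eq_add_pow (r - 1) 1 (leavesIn G A)
    simpa using this

/-- The subtree polynomial is obtained from the half-generalized degree polynomial by the
substitution `y = 1 + q (r - 1)`, `z = q`, up to a multiple of the number of edges. -/
theorem sum_stp_eq [Fintype V] {G : SimpleGraph V} (hG : G.IsAcyclic) {R : Type*} [CommRing R]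
    (q r : R) :
    ∑ A ∈ subtreeSets G, q ^ numInner G A * r ^ numLeafEdges G A +
      ((subtreeSets G).filter fun A => A.card = 2).card * (q * (r - 1)) =
    ∑ A ∈ subtreeSets G, (1 + q * (r - 1)) ^ numBoundary G A * q ^ numInner G A := by
  classical
  have h1 : ∑ A ∈ subtreeSets G, (1 + q * (r - 1)) ^ numBoundary G A * q ^ numInner G A =
      ∑ A ∈ subtreeSets G, ∑ L ∈ (outer G A).powerset,
        (r - 1) ^ L.card * q ^ (A.card + L.card - 1) := by
    refine Finset.sum_congr rfl fun A hA => ?_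
    have hin := numInner_add_one hG hA
    have := Finset.sum_pow_mul_eq_add_pow (q * (r - 1)) 1 (outer G A)
    rw [numBoundary_eq hG hA, add_comm, ← this, Finset.sum_mul]
    refine Finset.sum_congr rfl fun L _ => ?_
    rw [show A.card + L.card - 1 = L.card + numInner G A by omega, one_pow, mul_pow, pow_add]
    ring
  -- Reindex by (A, L) ↦ (A ∪ L, L): attaching a set of outer vertices is inverse to deleting a
  -- removable set.
  have h2 : ∑ A ∈ subtreeSets G, ∑ L ∈ (outer G A).powerset,
        (r - 1) ^ L.card * q ^ (A.card + L.card - 1) =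
      ∑ A ∈ subtreeSets G, ∑ L ∈ removable G A, (r - 1) ^ L.card * q ^ (A.card - 1) := by
    rw [Finset.sum_sigma', Finset.sum_sigma']
    refine Finset.sum_bij' (fun x _ => ⟨x.1 ∪ x.2, x.2⟩) (fun x _ => ⟨x.1 \ x.2, x.2⟩) ?_ ?_ ?_ ?_ ?_
    · rintro ⟨A, L⟩ h
      obtain ⟨hA, hL⟩ := Finset.mem_sigma.1 h
      have hL := Finset.mem_powerset.1 hL
      have hd : Disjoint A L :=
        Finset.disjoint_right.2 fun v hv => (mem_outer.1 (hL hv)).1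
      refine Finset.mem_sigma.2 ⟨union_mem_subtreeSets hA hL, ?_⟩
      simp only [removable, Finset.mem_filter, Finset.mem_powerset, Finset.subset_union_right,
        Finset.union_sdiff_cancel_right hd, true_and]
      exact ⟨hA, hL⟩
    · rintro ⟨A, L⟩ h
      obtain ⟨hA, hL⟩ := Finset.mem_sigma.1 h
      obtain ⟨hLA, h1, h2⟩ := Finset.mem_filter.1 hL
      exact Finset.mem_sigma.2 ⟨h1, Finset.mem_powerset.2 h2⟩
    · rintro ⟨A, L⟩ h
      obtain ⟨hA, hL⟩ := Finset.mem_sigma.1 h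
      have hL := Finset.mem_powerset.1 hL
      have hd : Disjoint A L :=
        Finset.disjoint_right.2 fun v hv => (mem_outer.1 (hL hv)).1
      simp [Finset.union_sdiff_cancel_right hd]
    · rintro ⟨A, L⟩ h
      obtain ⟨hA, hL⟩ := Finset.mem_sigma.1 h
      obtain ⟨hLA, h1, h2⟩ := Finset.mem_filter.1 hL
      simp [Finset.sdiff_union_of_subset (Finset.mem_powerset.1 hLA)]
    · rintro ⟨A, L⟩ h
      obtain ⟨hA, hL⟩ := Finset.mem_sigma.1 h
      have hL := Finset.mem_powerset.1 hL
      have hd : Disjoint A L :=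
        Finset.disjoint_right.2 fun v hv => (mem_outer.1 (hL hv)).1
      simp [Finset.card_union_of_disjoint hd]
  have h3 : ∀ A ∈ subtreeSets G, ∑ L ∈ removable G A, (r - 1) ^ L.card * q ^ (A.card - 1) =
      q ^ numInner G A * r ^ numLeafEdges G A + if A.card = 2 then q * (r - 1) else 0 := by
    intro A hA
    have hin := numInner_add_one hG hA
    rw [← Finset.sum_mul, sum_removable hG r hA, show A.card - 1 = numInner G A by omega]
    split_ifs with hc
    · rw [show numInner G A = 1 by omega]; ring
    · ring
  rw [h1, h2, Finset.sum_congr rfl h3, Finset.sum_add_distrib, ← Finset.sum_filter,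
    Finset.sum_const, nsmul_eq_mul]

/-- At y = 1 the coefficient of z counts the one-edge subtrees, the correction term in `sum_stp_eq`.
-/
theorem coeff_hdp_eq_card_pairs [Fintype V] {G : SimpleGraph V} (hG : G.IsAcyclic) :
    (MvPolynomial.aeval ![1, (Polynomial.X : Polynomial ℤ)] (hdp G)).coeff 1 =
      ((subtreeSets G).filter fun A => A.card = 2).card := by
  have : ∀ A ∈ subtreeSets G, (1 = numInner G A) ↔ A.card = 2 := fun A hA => by
    have := numInner_add_one hG hA
    omega
  simp only [hdp, map_sum, map_mul, map_pow, MvPolynomial.aeval_X, Matrix.cons_val_zero,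
    Matrix.cons_val_one, one_pow, one_mul, Polynomial.finsetSum_coeff, Polynomial.coeff_X_pow]
  rw [← Finset.sum_filter, Finset.filter_congr this]
  simp

/-- The half-generalized degree polynomial of a tree determines its subtree polynomial. -/
theorem stp_eq_of_hdp_eq [Fintype V] {W : Type*} [Fintype W] {G : SimpleGraph V}
    {H : SimpleGraph W} (hG : G.IsAcyclic) (hH : H.IsAcyclic) (h : hdp G = hdp H) :
    stp G = stp H := by
  have hc : (((subtreeSets G).filter fun A => A.card = 2).card : ℤ) =
      ((subtreeSets H).filter fun A => A.card = 2).card := by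
    rw [← coeff_hdp_eq_card_pairs hG, ← coeff_hdp_eq_card_pairs hH, h]
  have key := congrArg (MvPolynomial.aeval
    ![1 + MvPolynomial.X 0 * (MvPolynomial.X 1 - 1), (MvPolynomial.X 0 : MvPolynomial (Fin 2) ℤ)]) h
  simp only [hdp, map_sum, map_mul, map_pow, MvPolynomial.aeval_X, Matrix.cons_val_zero,
    Matrix.cons_val_one] at key
  rw [← sum_stp_eq hG, ← sum_stp_eq hH, Int.natCast_inj.1 hc] at key
  exact add_right_cancel key

end Trees

/-- Descending in rank reaches the root, so the graph is connected; every edge is a parent edge, so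
there are at most |V| - 1 of them. -/
theorem isTree_of_parent {V : Type*} [Finite V] {G : SimpleGraph V} (root : V) (p : V → V)
    (rank : V → ℕ) (hp : ∀ v, v ≠ root → G.Adj v (p v) ∧ rank (p v) < rank v)
    (hadj : ∀ u v, G.Adj u v → (u ≠ root ∧ v = p u) ∨ (v ≠ root ∧ u = p v)) : G.IsTree := by
  have hc : G.Connected := by
    rw [SimpleGraph.connected_iff_exists_forall_reachable]
    refine ⟨root, fun v => ?_⟩
    induction h : rank v using Nat.strong_induction_on generalizing v with
    | _ n ih =>
      by_cases hv : v = root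
      · rw [hv]
      · obtain ⟨h1, h2⟩ := hp v hv
        exact (ih _ (h ▸ h2) _ rfl).trans h1.symm.reachable
  refine SimpleGraph.isTree_iff_connected_and_card.2 ⟨hc, ?_⟩
  refine le_antisymm ?_ hc.card_vert_le_card_edgeSet_add_one
  have hsub : G.edgeSet ⊆ (fun v => s(v, p v)) '' {v | v ≠ root} := by
    intro e he
    induction e with
    | _ u v =>
      rcases hadj u v he with ⟨h, rfl⟩ | ⟨h, rfl⟩
      · exact ⟨u, h, rfl⟩
      · exact ⟨v, h, Sym2.eq_swap⟩
  have h1 := (Set.ncard_le_ncard hsub (Set.toFinite _)).trans (Set.ncard_image_le (Set.toFinite _))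
  have h2 := Set.ncard_add_ncard_compl ({root} : Set V) (Set.toFinite _) (Set.toFinite _)
  rw [Set.ncard_singleton] at h2
  have h3 : ({v | v ≠ root} : Set V) = {root}ᶜ := rfl
  rw [h3] at h1
  rw [Nat.card_coe_set_eq]
  omega

/-! ### Subtrees of caterpillars -/

section Caterpillar

variable {σ : List ℕ}

theorem CatVertex.ext {u v : CatVertex σ} (h1 : (u.1 : ℕ) = v.1) (h2 : (u.2 : ℕ) = v.2) :
    u = v := by
  obtain ⟨i, x⟩ := u
  obtain ⟨j, y⟩ := v
  obtain rfl : i = j := Fin.ext h1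
  obtain rfl : x = y := Fin.ext h2
  rfl

theorem cat_adj {u v : CatVertex σ} : (Cat σ).Adj u v ↔
    ((u.2 : ℕ) = 0 ∧ (v.2 : ℕ) = 0 ∧ ((u.1 : ℕ) + 1 = v.1 ∨ (v.1 : ℕ) + 1 = u.1)) ∨
    ((u.1 : ℕ) = v.1 ∧ (((u.2 : ℕ) = 0 ∧ (v.2 : ℕ) ≠ 0) ∨ ((u.2 : ℕ) ≠ 0 ∧ (v.2 : ℕ) = 0))) := by
  simp only [Cat, SimpleGraph.fromRel_adj, Fin.ext_iff]
  constructor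
  · rintro ⟨-, (⟨h1, h2, h3⟩ | ⟨h1, h2, h3⟩) | (⟨h1, h2, h3⟩ | ⟨h1, h2, h3⟩)⟩ <;> omega
  · intro h
    refine ⟨?_, by omega⟩
    rintro rfl
    omega

/-- The `i`-th spine vertex. -/
def catSpine (hσ : ∀ a ∈ σ, 0 < a) (i : Fin σ.length) : CatVertex σ :=
  ⟨i, 0, hσ _ (List.get_mem σ i)⟩

theorem eq_catSpine (hσ : ∀ a ∈ σ, 0 < a) {v : CatVertex σ} (hv : (v.2 : ℕ) = 0) :
    v = catSpine hσ v.1 := CatVertex.ext rfl hv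

theorem catSpine_fst (hσ : ∀ a ∈ σ, 0 < a) (i : Fin σ.length) : (catSpine hσ i).1 = i := rfl

theorem catSpine_snd (hσ : ∀ a ∈ σ, 0 < a) (i : Fin σ.length) :
    ((catSpine hσ i).2 : ℕ) = 0 := rfl

theorem isTree_cat (hσ : IsComposition σ) : (Cat σ).IsTree := by
  have hpos := List.length_pos_of_ne_nil hσ.1
  -- The parent of a leaf is its spine vertex, and that of a spine vertex is the preceding one.
  -- Truncated subtraction makes the root its own parent, which is harmless.
  let p : CatVertex σ → CatVertex σ := fun v =>
    if (v.2 : ℕ) = 0 then catSpine hσ.2 ⟨v.1 - 1, by omega⟩ else catSpine hσ.2 v.1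
  have p1 : ∀ v, ((p v).1 : ℕ) = if (v.2 : ℕ) = 0 then (v.1 : ℕ) - 1 else v.1 := fun v => by
    simp only [p]
    split_ifs <;> rfl
  have p2 : ∀ v, ((p v).2 : ℕ) = 0 := fun v => by
    by_cases h : (v.2 : ℕ) = 0
    · rw [show p v = catSpine hσ.2 ⟨v.1 - 1, by omega⟩ from if_pos h, catSpine_snd]
    · rw [show p v = catSpine hσ.2 v.1 from if_neg h, catSpine_snd]
  refine isTree_of_parent (catSpine hσ.2 ⟨0, hpos⟩) p (fun v => (v.1 : ℕ) + v.2) ?_ ?_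
  · intro v hv
    rw [cat_adj, p1, p2]
    by_cases h0 : (v.2 : ℕ) = 0
    · have h1 : (v.1 : ℕ) ≠ 0 := fun h => hv (CatVertex.ext h h0)
      rw [if_pos h0]
      omega
    · rw [if_neg h0]
      omega
  · intro u v huv
    have hr : ∀ w : CatVertex σ, (w.1 : ℕ) ≠ 0 ∨ (w.2 : ℕ) ≠ 0 → w ≠ catSpine hσ.2 ⟨0, hpos⟩ := by
      rintro w hw rfl
      simp [catSpine] at hw
    rcases cat_adj.1 huv with ⟨h1, h2, h3 | h3⟩ | ⟨h1, ⟨h2, h3⟩ | ⟨h2, h3⟩⟩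
    · refine .inr ⟨hr _ (by omega), CatVertex.ext ?_ ?_⟩
      · rw [p1, if_pos h2]; omega
      · rw [p2, h1]
    · refine .inl ⟨hr _ (by omega), CatVertex.ext ?_ ?_⟩
      · rw [p1, if_pos h1]; omega
      · rw [p2, h2]
    · refine .inr ⟨hr _ (by omega), CatVertex.ext ?_ ?_⟩
      · rw [p1, if_neg h3, h1]
      · rw [p2, h2]
    · refine .inl ⟨hr _ (by omega), CatVertex.ext ?_ ?_⟩
      · rw [p1, if_neg h2, h1]
      · rw [p2, h3]

/-- The spine vertices with index in `[i, j]`. -/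
def spineSeg (σ : List ℕ) (i j : ℕ) : Finset (CatVertex σ) :=
  Finset.univ.filter fun v => (v.2 : ℕ) = 0 ∧ i ≤ v.1 ∧ (v.1 : ℕ) ≤ j

/-- The leaves attached to the spine vertices with index in `[i, j]`. -/
def leafSeg (σ : List ℕ) (i j : ℕ) : Finset (CatVertex σ) :=
  Finset.univ.filter fun v => (v.2 : ℕ) ≠ 0 ∧ i ≤ v.1 ∧ (v.1 : ℕ) ≤ j

theorem mem_spineSeg {i j : ℕ} {v : CatVertex σ} :
    v ∈ spineSeg σ i j ↔ (v.2 : ℕ) = 0 ∧ i ≤ v.1 ∧ (v.1 : ℕ) ≤ j := by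
  simp [spineSeg]

theorem mem_leafSeg {i j : ℕ} {v : CatVertex σ} :
    v ∈ leafSeg σ i j ↔ (v.2 : ℕ) ≠ 0 ∧ i ≤ v.1 ∧ (v.1 : ℕ) ≤ j := by
  simp [leafSeg]

theorem spineSeg_mem_subtreeSets (hσ : ∀ a ∈ σ, 0 < a) {i j : ℕ} (hij : i ≤ j)
    (hj : j < σ.length) : spineSeg σ i j ∈ subtreeSets (Cat σ) := by
  have hi : i < σ.length := by omega
  refine mem_subtreeSets_of_root (u := catSpine hσ ⟨i, hi⟩)
    (mem_spineSeg.2 ⟨rfl, le_rfl, hij⟩) fun v hv => ?_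
  obtain ⟨h0, h1, h2⟩ := mem_spineSeg.1 hv
  have key : ∀ t, i ≤ t → ∀ ht : t < σ.length, t ≤ j →
      Relation.ReflTransGen (StepIn (Cat σ) (spineSeg σ i j)) (catSpine hσ ⟨i, hi⟩)
        (catSpine hσ ⟨t, ht⟩) := by
    intro t hit
    induction t, hit using Nat.le_induction with
    | base => exact fun _ _ => .refl
    | succ t hit ih =>
      intro ht htj
      refine (ih (by omega) (by omega)).tail
        ⟨mem_spineSeg.2 ⟨rfl, hit, by simp [catSpine]; omega⟩,
          mem_spineSeg.2 ⟨rfl, by simp [catSpine]; omega, htj⟩, cat_adj.2 (.inl ⟨rfl, rfl, .inl rfl⟩)⟩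
  rw [eq_catSpine hσ h0]
  exact key v.1 h1 v.1.2 h2

theorem leafSeg_subset_outer (hσ : ∀ a ∈ σ, 0 < a) (i j : ℕ) :
    leafSeg σ i j ⊆ outer (Cat σ) (spineSeg σ i j) := by
  intro v hv
  obtain ⟨h0, h1, h2⟩ := mem_leafSeg.1 hv
  refine mem_outer.2 ⟨fun h => h0 (mem_spineSeg.1 h).1, catSpine hσ v.1,
    mem_spineSeg.2 ⟨rfl, h1, h2⟩, cat_adj.2 (.inr ⟨rfl, .inr ⟨h0, rfl⟩⟩)⟩

/-- A leaf in a subtree with another vertex forces its spine vertex into the subtree, and the spine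
vertices present form an interval. -/
theorem subtreeSets_cat_cases (hσ : ∀ a ∈ σ, 0 < a) {A : Finset (CatVertex σ)}
    (hA : A ∈ subtreeSets (Cat σ)) :
    (∃ v : CatVertex σ, (v.2 : ℕ) ≠ 0 ∧ A = {v}) ∨
    ∃ i j : ℕ, i ≤ j ∧ j < σ.length ∧ ∃ B ⊆ leafSeg σ i j, A = spineSeg σ i j ∪ B := by
  obtain ⟨⟨x, hx⟩, hconn⟩ := mem_subtreeSets.1 hA
  have hstep : ∀ v ∈ A, ∀ w ∈ A, (v.2 : ℕ) ≠ 0 → v ≠ w → catSpine hσ v.1 ∈ A := by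
    intro v hv w hw hv0 hvw
    rcases Relation.ReflTransGen.cases_head (hconn v hv w hw) with h | ⟨y, hs, -⟩
    · exact absurd h hvw
    · have hy := cat_adj.1 hs.2.2
      have : y = catSpine hσ v.1 := CatVertex.ext (by simp [catSpine]; omega) (by
        simp [catSpine]; omega)
      exact this ▸ hs.2.1
  by_cases hsp : ∃ v ∈ A, (v.2 : ℕ) = 0
  · right
    let S := A.filter fun v => (v.2 : ℕ) = 0
    have hS : S.Nonempty := by
      obtain ⟨v, hv, h0⟩ := hsp
      exact ⟨v, Finset.mem_filter.2 ⟨hv, h0⟩⟩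
    obtain ⟨u, hu, hmin⟩ := S.exists_min_image (fun v => (v.1 : ℕ)) hS
    obtain ⟨w, hw, hmax⟩ := S.exists_max_image (fun v => (v.1 : ℕ)) hS
    obtain ⟨huA, hu0⟩ := Finset.mem_filter.1 hu
    obtain ⟨hwA, hw0⟩ := Finset.mem_filter.1 hw
    have hbound : ∀ v ∈ A, (u.1 : ℕ) ≤ v.1 ∧ (v.1 : ℕ) ≤ w.1 := by
      intro v hv
      by_cases h0 : (v.2 : ℕ) = 0
      · exact ⟨hmin v (Finset.mem_filter.2 ⟨hv, h0⟩), hmax v (Finset.mem_filter.2 ⟨hv, h0⟩)⟩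
      · have hs := hstep v hv u huA h0 (by rintro rfl; exact h0 hu0)
        exact ⟨hmin (catSpine hσ v.1) (Finset.mem_filter.2 ⟨hs, rfl⟩),
          hmax (catSpine hσ v.1) (Finset.mem_filter.2 ⟨hs, rfl⟩)⟩
    have hseg : spineSeg σ u.1 w.1 ⊆ A := by
      intro v hv
      obtain ⟨h0, h1, h2⟩ := mem_spineSeg.1 hv
      by_contra hvA
      -- A walk in A can pass from an index below that of v to one not below it only by stepping
      -- onto v itself.
      have hlt : ∀ y, Relation.ReflTransGen (StepIn (Cat σ) A) u y → (y.1 : ℕ) < v.1 := by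
        intro y hy
        induction hy with
        | refl => exact lt_of_le_of_ne h1 fun h => hvA (CatVertex.ext h (hu0.trans h0.symm) ▸ huA)
        | @tail y z _ hs ih =>
          have hyz := cat_adj.1 hs.2.2
          by_contra hlt
          have : z = v := CatVertex.ext (by omega) (by omega)
          exact hvA (this ▸ hs.2.1)
      have := hlt w (hconn u huA w hwA)
      omega
    refine ⟨u.1, w.1, (hbound u huA).2, w.1.2, A.filter fun v => (v.2 : ℕ) ≠ 0, ?_, ?_⟩
    · intro v hv
      obtain ⟨hv, h0⟩ := Finset.mem_filter.1 hv
      exact mem_leafSeg.2 ⟨h0, hbound v hv⟩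
    · ext v
      rw [Finset.mem_union, Finset.mem_filter]
      constructor
      · intro hv
        by_cases h0 : (v.2 : ℕ) = 0
        · exact .inl (mem_spineSeg.2 ⟨h0, hbound v hv⟩)
        · exact .inr ⟨hv, h0⟩
      · rintro (hv | hv)
        exacts [hseg hv, hv.1]
  · left
    push Not at hsp
    refine ⟨x, hsp x hx, Finset.eq_singleton_iff_unique_mem.2 ⟨hx, fun w hw => ?_⟩⟩
    by_contra hne
    exact hsp _ (hstep x hx w hw (hsp x hx) (Ne.symm hne)) rfl

theorem spineSeg_union_inj (hσ : ∀ a ∈ σ, 0 < a) {i j i' j' : ℕ} (hij : i ≤ j)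
    (hj : j < σ.length) (hij' : i' ≤ j') (hj' : j' < σ.length) {B B' : Finset (CatVertex σ)}
    (hB : B ⊆ leafSeg σ i j) (hB' : B' ⊆ leafSeg σ i' j')
    (h : spineSeg σ i j ∪ B = spineSeg σ i' j' ∪ B') : i = i' ∧ j = j' ∧ B = B' := by
  have key : ∀ {i j i' j' : ℕ} {B B' : Finset (CatVertex σ)}, B' ⊆ leafSeg σ i' j' →
      spineSeg σ i j ∪ B = spineSeg σ i' j' ∪ B' → ∀ t (ht : t < σ.length), i ≤ t → t ≤ j →
      i' ≤ t ∧ t ≤ j' := by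
    intro i j i' j' B B' hB' h t ht h1 h2
    have : catSpine hσ ⟨t, ht⟩ ∈ spineSeg σ i' j' ∪ B' := by
      rw [← h]
      exact Finset.mem_union_left _ (mem_spineSeg.2 ⟨rfl, h1, h2⟩)
    rcases Finset.mem_union.1 this with h | h
    · exact (mem_spineSeg.1 h).2
    · exact absurd rfl (mem_leafSeg.1 (hB' h)).1
  have k1 := key hB' h i (by omega) le_rfl hij
  have k2 := key hB' h j hj hij le_rfl
  have k3 := key hB h.symm i' (by omega) le_rfl hij'
  have k4 := key hB h.symm j' hj' hij' le_rfl
  obtain rfl : i = i' := by omega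
  obtain rfl : j = j' := by omega
  refine ⟨rfl, rfl, ?_⟩
  have key2 : ∀ {B B' : Finset (CatVertex σ)}, B ⊆ leafSeg σ i j →
      spineSeg σ i j ∪ B = spineSeg σ i j ∪ B' → B ⊆ B' := by
    intro B B' hB h v hv
    have : v ∈ spineSeg σ i j ∪ B' := h ▸ Finset.mem_union_right _ hv
    rcases Finset.mem_union.1 this with h | h
    · exact absurd (mem_spineSeg.1 h).1 (mem_leafSeg.1 (hB hv)).1
    · exact h
  exact (key2 hB h).antisymm (key2 hB' h.symm)

theorem outer_leaf (hσ : ∀ a ∈ σ, 0 < a) {v : CatVertex σ} (hv : (v.2 : ℕ) ≠ 0) :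
    outer (Cat σ) {v} = {catSpine hσ v.1} := by
  ext w
  simp only [mem_outer, Finset.mem_singleton, exists_eq_left]
  constructor
  · rintro ⟨-, h⟩
    have := cat_adj.1 h
    exact CatVertex.ext (by simp [catSpine]; omega) (by simp [catSpine]; omega)
  · rintro rfl
    refine ⟨?_, cat_adj.2 (.inr ⟨rfl, .inl ⟨rfl, hv⟩⟩)⟩
    intro h
    exact hv (by rw [← h]; rfl)

theorem outer_spineSeg_union (hσ : ∀ a ∈ σ, 0 < a) {i j : ℕ} (hij : i ≤ j) (hj : j < σ.length)
    {B : Finset (CatVertex σ)} (hB : B ⊆ leafSeg σ i j) :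
    outer (Cat σ) (spineSeg σ i j ∪ B) = (leafSeg σ i j \ B) ∪
      ((Finset.univ.filter fun v : CatVertex σ => (v.2 : ℕ) = 0 ∧ (v.1 : ℕ) + 1 = i) ∪
      Finset.univ.filter fun v : CatVertex σ => (v.2 : ℕ) = 0 ∧ (v.1 : ℕ) = j + 1) := by
  ext v
  simp only [mem_outer, Finset.mem_union, Finset.mem_sdiff, Finset.mem_filter,
    Finset.mem_univ, true_and, mem_spineSeg, mem_leafSeg]
  constructor
  · rintro ⟨hv, a, ha, hva⟩
    have hadj := cat_adj.1 hva
    have ha' : (i ≤ (a.1 : ℕ) ∧ (a.1 : ℕ) ≤ j) := by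
      rcases ha with ha | ha
      · exact ha.2
      · exact (mem_leafSeg.1 (hB ha)).2
    by_cases hvB : v ∈ B
    · exact absurd (.inr hvB) hv
    · simp only [hvB, or_false, not_false_eq_true, and_true] at hv ⊢
      omega
  · have hBl : v ∈ B → (v.2 : ℕ) ≠ 0 := fun h => (mem_leafSeg.1 (hB h)).1
    rintro (⟨h, hvB⟩ | ⟨h0, h⟩ | ⟨h0, h⟩)
    · refine ⟨fun h' => h'.elim (fun h' => h.1 h'.1) hvB, catSpine hσ v.1, .inl ⟨rfl, h.2⟩,
        cat_adj.2 (.inr ⟨rfl, .inr ⟨h.1, rfl⟩⟩)⟩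
    · refine ⟨fun h' => h'.elim (fun h' => by omega) fun h' => hBl h' h0,
        catSpine hσ ⟨i, by omega⟩, .inl ⟨rfl, le_rfl, hij⟩,
        cat_adj.2 (.inl ⟨h0, rfl, .inl h⟩)⟩
    · refine ⟨fun h' => h'.elim (fun h' => by omega) fun h' => hBl h' h0,
        catSpine hσ ⟨j, hj⟩, .inl ⟨rfl, hij, le_rfl⟩,
        cat_adj.2 (.inl ⟨h0, rfl, .inr h.symm⟩)⟩

theorem card_spine_index (hσ : ∀ a ∈ σ, 0 < a) (p : ℕ → Prop) [DecidablePred p] :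
    (Finset.univ.filter fun v : CatVertex σ => (v.2 : ℕ) = 0 ∧ p v.1).card =
      ((Finset.range σ.length).filter p).card := by
  refine Finset.card_bij (fun v _ => (v.1 : ℕ)) ?_ ?_ ?_
  · intro v hv
    simpa using (Finset.mem_filter.1 hv).2.2
  · intro v hv w hw h
    exact CatVertex.ext h ((Finset.mem_filter.1 hv).2.1.trans (Finset.mem_filter.1 hw).2.1.symm)
  · intro t ht
    obtain ⟨h1, h2⟩ := Finset.mem_filter.1 ht
    exact ⟨catSpine hσ ⟨t, by simpa using h1⟩, by simpa [catSpine] using h2, rfl⟩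

theorem card_spineSeg (hσ : ∀ a ∈ σ, 0 < a) {i j : ℕ} (hj : j < σ.length) :
    (spineSeg σ i j).card = j + 1 - i := by
  rw [spineSeg, card_spine_index hσ fun t => i ≤ t ∧ t ≤ j, ← Nat.card_Icc]
  congr 1
  ext t
  simp
  omega

theorem card_leaves_at {t : ℕ} (ht : t < σ.length) :
    (Finset.univ.filter fun v : CatVertex σ => (v.2 : ℕ) ≠ 0 ∧ (v.1 : ℕ) = t).card =
      σ.getD t 0 - 1 := by
  have h1 : ∀ n, (Finset.univ.filter fun x : Fin n => (x : ℕ) ≠ 0).card = n - 1 := by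
    intro n
    cases n with
    | zero => rfl
    | succ n =>
      have : (Finset.univ.filter fun x : Fin (n + 1) => (x : ℕ) ≠ 0) = Finset.univ.erase 0 := by
        ext x
        simp only [Finset.mem_filter, Finset.mem_univ, true_and, Finset.mem_erase, and_true,
          Ne, Fin.ext_iff, Fin.val_zero]
      rw [this, Finset.card_erase_of_mem (Finset.mem_univ _)]
      simp
  rw [show σ.getD t 0 = σ.get ⟨t, ht⟩ by simp [ht], ← h1]
  refine (Finset.card_bij (fun x _ => ⟨⟨t, ht⟩, x⟩) ?_ ?_ ?_).symm
  · intro x hx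
    simpa using hx
  · intro x _ y _ h
    simpa using h
  · rintro ⟨⟨i, hi⟩, x⟩ h
    obtain ⟨h0, rfl⟩ : (x : ℕ) ≠ 0 ∧ i = t := (Finset.mem_filter.1 h).2
    exact ⟨x, Finset.mem_filter.2 ⟨Finset.mem_univ _, h0⟩, rfl⟩

theorem card_leafSeg {i j : ℕ} (hj : j < σ.length) :
    (leafSeg σ i j).card = ∑ t ∈ Finset.Ico i (j + 1), (σ.getD t 0 - 1) := by
  rw [Finset.card_eq_sum_card_fiberwise (f := fun v : CatVertex σ => (v.1 : ℕ))
    (t := Finset.Ico i (j + 1))]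
  · refine Finset.sum_congr rfl fun t ht => ?_
    rw [Finset.mem_Ico] at ht
    rw [← card_leaves_at (show t < σ.length by omega)]
    congr 1
    ext v
    simp only [Finset.mem_filter, mem_leafSeg, Finset.mem_univ, true_and]
    omega
  · intro v hv
    have := mem_leafSeg.1 hv
    simp
    omega

theorem card_outer_spineSeg_union (hσ : ∀ a ∈ σ, 0 < a) {i j : ℕ} (hij : i ≤ j)
    (hj : j < σ.length) {B : Finset (CatVertex σ)} (hB : B ⊆ leafSeg σ i j) :
    (outer (Cat σ) (spineSeg σ i j ∪ B)).card = ((leafSeg σ i j).card - B.card) +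
      ((if i = 0 then 0 else 1) + if j + 1 < σ.length then 1 else 0) := by
  rw [outer_spineSeg_union hσ hij hj hB, Finset.card_union_of_disjoint,
    Finset.card_union_of_disjoint, Finset.card_sdiff_of_subset hB,
    card_spine_index hσ fun t => t + 1 = i, card_spine_index hσ fun t => t = j + 1]
  · congr 2
    · split_ifs with h
      · simp [h]
      · rw [Finset.card_eq_one]
        exact ⟨i - 1, by
          ext t; simp only [Finset.mem_filter, Finset.mem_range, Finset.mem_singleton]; omega⟩
    · split_ifs with h
      · rw [Finset.card_eq_one]
        exact ⟨j + 1, by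
          ext t; simp only [Finset.mem_filter, Finset.mem_range, Finset.mem_singleton]; omega⟩
      · rw [Finset.card_eq_zero]
        ext t; simp only [Finset.mem_filter, Finset.mem_range, Finset.notMem_empty,
          iff_false]; omega
  · rw [Finset.disjoint_left]
    intro v h1 h2
    have h1 := (Finset.mem_filter.1 h1).2
    have h2 := (Finset.mem_filter.1 h2).2
    omega
  · rw [Finset.disjoint_left]
    intro v h1 h2
    have h1 := mem_leafSeg.1 (Finset.mem_sdiff.1 h1).1
    simp only [Finset.mem_union, Finset.mem_filter] at h2
    omega

theorem sum_subtreeSets_cat (hσ : ∀ a ∈ σ, 0 < a) {M : Type*} [AddCommMonoid M]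
    (F : Finset (CatVertex σ) → M) :
    ∑ A ∈ subtreeSets (Cat σ), F A =
      (∑ v ∈ Finset.univ.filter fun v : CatVertex σ => (v.2 : ℕ) ≠ 0, F {v}) +
      ∑ i ∈ Finset.range σ.length, ∑ j ∈ Finset.Ico i σ.length,
        ∑ B ∈ (leafSeg σ i j).powerset, F (spineSeg σ i j ∪ B) := by
  let L : Finset (CatVertex σ) := Finset.univ.filter fun v => (v.2 : ℕ) ≠ 0
  let P : Finset ((_ : ℕ) × (_ : ℕ) × Finset (CatVertex σ)) := (Finset.range σ.length).sigma
    fun i => (Finset.Ico i σ.length).sigma fun j => (leafSeg σ i j).powerset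
  have hP : ∀ {i j B}, ⟨i, j, B⟩ ∈ P ↔ i ≤ j ∧ j < σ.length ∧ B ⊆ leafSeg σ i j := by
    intro i j B
    simp only [P, Finset.mem_sigma, Finset.mem_range, Finset.mem_Ico, Finset.mem_powerset]
    constructor
    · rintro ⟨h1, ⟨h2, h3⟩, h4⟩
      exact ⟨h2, h3, h4⟩
    · rintro ⟨h1, h2, h3⟩
      exact ⟨by omega, ⟨h1, h2⟩, h3⟩
  have hset : subtreeSets (Cat σ) =
      L.image (fun v => {v}) ∪ P.image fun x => spineSeg σ x.1 x.2.1 ∪ x.2.2 := by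
    ext A
    simp only [Finset.mem_union, Finset.mem_image]
    constructor
    · intro hA
      rcases subtreeSets_cat_cases hσ hA with ⟨v, hv, rfl⟩ | ⟨i, j, hij, hj, B, hB, rfl⟩
      · exact .inl ⟨v, by simpa [L] using hv, rfl⟩
      · exact .inr ⟨⟨i, j, B⟩, hP.2 ⟨hij, hj, hB⟩, rfl⟩
    · rintro (⟨v, -, rfl⟩ | ⟨⟨i, j, B⟩, h, rfl⟩)
      · exact singleton_mem_subtreeSets _ v
      · obtain ⟨hij, hj, hB⟩ := hP.1 h
        exact union_mem_subtreeSets (spineSeg_mem_subtreeSets hσ hij hj)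
          (hB.trans (leafSeg_subset_outer hσ i j))
  rw [hset, Finset.sum_union, Finset.sum_image, Finset.sum_image]
  · congr 1
    rw [Finset.sum_sigma]
    exact Finset.sum_congr rfl fun i _ => Finset.sum_sigma _ _ _
  · rintro ⟨i, j, B⟩ h ⟨i', j', B'⟩ h' heq
    obtain ⟨hij, hj, hB⟩ := hP.1 h
    obtain ⟨hij', hj', hB'⟩ := hP.1 h'
    obtain ⟨rfl, rfl, rfl⟩ := spineSeg_union_inj hσ hij hj hij' hj' hB hB' heq
    rfl
  · intro v _ w _ h
    simpa using h
  · rw [Finset.disjoint_left]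
    intro A h1 h2
    obtain ⟨v, hv, rfl⟩ := Finset.mem_image.1 h1
    obtain ⟨⟨i, j, B⟩, h, heq⟩ := Finset.mem_image.1 h2
    obtain ⟨hij, hj, hB⟩ := hP.1 h
    have : catSpine hσ ⟨j, hj⟩ ∈ ({v} : Finset (CatVertex σ)) := by
      rw [← heq]
      exact Finset.mem_union_left _ (mem_spineSeg.2 ⟨rfl, hij, le_rfl⟩)
    rw [Finset.mem_singleton] at this
    exact (Finset.mem_filter.1 hv).2 (by rw [← this]; rfl)

theorem card_leaves_cat (hσ : ∀ a ∈ σ, 0 < a) :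
    (Finset.univ.filter fun v : CatVertex σ => (v.2 : ℕ) ≠ 0).card + σ.length = σ.sum := by
  have h1 := card_spine_index hσ fun _ => True
  have h2 := Finset.card_filter_add_card_filter_not
    (s := (Finset.univ : Finset (CatVertex σ))) (fun v => (v.2 : ℕ) = 0)
  have h3 : (Finset.univ : Finset (CatVertex σ)).card = σ.sum := by
    rw [Finset.card_univ, Fintype.card_sigma]
    simp only [Fintype.card_fin, List.get_eq_getElem]
    exact Fin.sum_univ_getElem σ
  simp only [and_true, Finset.filter_true, Finset.card_range] at h1
  rw [h1, h3] at h2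
  rw [← h2, add_comm]

/-- The contribution to the half-generalized degree polynomial of the subtrees of a caterpillar
whose spine part starts at the first spine vertex. -/
def initialSum {R : Type*} [CommRing R] (y z : R) : List ℕ → R
  | [] => 0
  | [a] => (y + z) ^ (a - 1)
  | a :: b :: l => (y + z) ^ (a - 1) * (y + z * initialSum y z (b :: l))

/-- The contribution of the subtrees whose spine part starts later. -/
def laterSum {R : Type*} [CommRing R] (y z : R) : List ℕ → R
  | [] => 0
  | a :: l => y * initialSum y z (a :: l) + laterSum y z l

/-- Here j is the last spine index covered: j spine edges are used, a boundary edge follows unless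
the spine ends, and each attached leaf lies inside (z) or on the boundary (y). -/
theorem sum_range_eq_initialSum {R : Type*} [CommRing R] (y z : R) (σ : List ℕ) :
    ∑ j ∈ Finset.range σ.length, z ^ j * (if j + 1 < σ.length then y else 1) *
      (y + z) ^ (∑ t ∈ Finset.range (j + 1), (σ.getD t 0 - 1)) = initialSum y z σ := by
  induction σ with
  | nil => rfl
  | cons a l ih =>
    cases l with
    | nil => simp [initialSum]
    | cons b l =>
      rw [List.length_cons, Finset.sum_range_succ', initialSum, ← ih, mul_add, Finset.mul_sum,
        Finset.mul_sum, add_comm]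
      congr 1
      · simp; ring
      · refine Finset.sum_congr rfl fun j _ => ?_
        rw [Finset.sum_range_succ']
        simp only [List.getD_cons_succ, List.getD_cons_zero, Nat.add_lt_add_iff_right, pow_add,
          pow_one]
        ring

theorem sum_range_eq_laterSum {R : Type*} [CommRing R] (y z : R) (σ : List ℕ) :
    ∑ i ∈ Finset.range σ.length, y * initialSum y z (σ.drop i) = laterSum y z σ := by
  induction σ with
  | nil => rfl
  | cons a l ih =>
    rw [List.length_cons, Finset.sum_range_succ', laterSum, ← ih, add_comm]
    simp

/-- The first term counts single leaves, each with one boundary edge. A subtree whose spine part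
starts after the first vertex has an extra boundary edge on the left, the factor y in `laterSum`. -/
theorem hdp_cat (hσ : IsComposition σ) :
    hdp (Cat σ) = ((σ.sum - σ.length : ℕ) : MvPolynomial (Fin 2) ℤ) * MvPolynomial.X 0 +
      (initialSum (MvPolynomial.X 0) (MvPolynomial.X 1) σ +
        laterSum (MvPolynomial.X 0) (MvPolynomial.X 1) σ.tail) := by
  set y : MvPolynomial (Fin 2) ℤ := MvPolynomial.X 0 with hy
  set z : MvPolynomial (Fin 2) ℤ := MvPolynomial.X 1 with hz
  rw [hdp_eq_sum_outer (isTree_cat hσ).isAcyclic, sum_subtreeSets_cat hσ.2]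
  congr 1
  · rw [← card_leaves_cat hσ.2, Nat.add_sub_cancel, ← nsmul_eq_mul, ← Finset.sum_const]
    refine Finset.sum_congr rfl fun v hv => ?_
    rw [outer_leaf hσ.2 (Finset.mem_filter.1 hv).2]
    simp [hy]
  · have h1 : ∀ i ∈ Finset.range σ.length, ∑ j ∈ Finset.Ico i σ.length,
        ∑ B ∈ (leafSeg σ i j).powerset, y ^ (outer (Cat σ) (spineSeg σ i j ∪ B)).card *
          z ^ ((spineSeg σ i j ∪ B).card - 1) =
        (if i = 0 then 1 else y) * initialSum y z (σ.drop i) := by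
      intro i hi
      rw [← sum_range_eq_initialSum, Finset.sum_Ico_eq_sum_range, List.length_drop,
        Finset.mul_sum]
      refine Finset.sum_congr rfl fun d hd => ?_
      rw [Finset.mem_range] at hi hd
      have hj : i + d < σ.length := by omega
      have e1 : ∑ t ∈ Finset.range (d + 1), ((σ.drop i).getD t 0 - 1) =
          (leafSeg σ i (i + d)).card := by
        rw [card_leafSeg hj, Finset.sum_Ico_eq_sum_range, show i + d + 1 - i = d + 1 by omega]
        simp [List.getD_eq_getElem?_getD]
      rw [e1, add_comm y z, ← Finset.sum_pow_mul_eq_add_pow, Finset.mul_sum, Finset.mul_sum]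
      refine Finset.sum_congr rfl fun B hB => ?_
      have hB := Finset.mem_powerset.1 hB
      have hd' : Disjoint (spineSeg σ i (i + d)) B := by
        rw [Finset.disjoint_left]
        exact fun v h1 h2 => (mem_leafSeg.1 (hB h2)).1 (mem_spineSeg.1 h1).1
      rw [card_outer_spineSeg_union hσ.2 (by omega) hj hB, Finset.card_union_of_disjoint hd',
        card_spineSeg hσ.2 hj, show i + d + 1 - i + B.card - 1 = d + B.card by omega, pow_add,
        pow_add, pow_add]
      have e2 : y ^ (if i = 0 then 0 else 1) = if i = 0 then 1 else y := by split_ifs <;> simp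
      have e3 : y ^ (if i + d + 1 < σ.length then 1 else 0) =
          if d + 1 < σ.length - i then y else 1 := by
        have : i + d + 1 < σ.length ↔ d + 1 < σ.length - i := by omega
        simp only [this]
        split_ifs <;> simp
      rw [e2, e3]
      ring
    rw [Finset.sum_congr rfl h1]
    obtain ⟨a, l, rfl⟩ := List.exists_cons_of_ne_nil hσ.1
    rw [List.length_cons, Finset.sum_range_succ', List.tail_cons, ← sum_range_eq_laterSum,
      add_comm]
    simp

end Caterpillar

/-! ### Padding -/

/-- The appended 1 reaches the first part only when `l` is empty. Since c and m do not depend on n,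
a cut and a merge at the front can be compared uniformly. -/
theorem exists_nearConcat_one (b : ℕ) (l : List ℕ) :
    ∃ c m, b ≤ c ∧ ∀ n, nearConcat ((n + b) :: l) [1] = (n + c) :: m := by
  cases l with
  | nil => exact ⟨b + 1, [], by omega, fun n => by rw [nearConcat_singleton_cons, add_assoc]⟩
  | cons d l => exact ⟨b, nearConcat (d :: l) [1], le_rfl, fun n => nearConcat_cons_cons _ _ _ _⟩

theorem pad_cons (a : ℕ) (l : List ℕ) : pad (a :: l) = nearConcat ((1 + a) :: l) [1] := by
  rw [pad, nearConcat_singleton_cons]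

theorem IsComposition.pad {α : List ℕ} (hα : IsComposition α) : IsComposition (pad α) :=
  (isComposition_singleton_one.nearConcat hα).nearConcat isComposition_singleton_one

theorem sum_pad {α : List ℕ} (hα : α ≠ []) : (pad α).sum = α.sum + 2 := by
  rw [pad, sum_nearConcat (nearConcat_ne_nil _ _) (by simp), sum_nearConcat (by simp) hα]
  simp
  omega

theorem length_pad {α : List ℕ} (hα : α ≠ []) : (pad α).length = α.length := by
  have h1 := length_nearConcat (nearConcat_ne_nil [1] α) (show [1] ≠ [] by simp)
  have h2 := length_nearConcat (show [1] ≠ [] by simp) hα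
  simp only [List.length_singleton] at h1 h2
  rw [pad]
  omega

theorem pad_reverse {α : List ℕ} (hα : α ≠ []) : pad α.reverse = (pad α).reverse := by
  rw [pad, pad, nearConcat_reverse (nearConcat_ne_nil _ _) (by simp),
    nearConcat_reverse (by simp) hα, nearConcat_assoc (by simp) (by simpa using hα) (by simp)]
  rfl

theorem pad_injective {α β : List ℕ} (hα : α ≠ []) (hβ : β ≠ []) (h : pad α = pad β) :
    α = β := by
  have h1 : ∀ {X Y : List ℕ}, X ≠ [] → Y ≠ [] → nearConcat X [1] = nearConcat Y [1] → X = Y := by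
    intro X Y hX hY h
    obtain ⟨U, u, rfl⟩ := List.eq_nil_or_concat' X |>.resolve_left hX
    obtain ⟨W, w, rfl⟩ := List.eq_nil_or_concat' Y |>.resolve_left hY
    rw [nearConcat_append_singleton_cons, nearConcat_append_singleton_cons] at h
    obtain ⟨h1, h2⟩ := List.append_inj' h rfl
    rw [h1, show u = w by simpa using h2]
  have h2 := h1 (nearConcat_ne_nil _ _) (nearConcat_ne_nil _ _) h
  obtain ⟨a, l, rfl⟩ := List.exists_cons_of_ne_nil hα
  obtain ⟨b, m, rfl⟩ := List.exists_cons_of_ne_nil hβ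
  rw [nearConcat_singleton_cons, nearConcat_singleton_cons] at h2
  simpa using h2

theorem isSignature_pad {α : List ℕ} (hα : IsComposition α) : IsSignature (pad α) := by
  refine ⟨hα.pad, ?_, ?_⟩
  · obtain ⟨a, l, rfl⟩ := List.exists_cons_of_ne_nil hα.1
    obtain ⟨c, m, hc, h⟩ := exists_nearConcat_one a l
    have := hα.2 a (by simp)
    rw [pad_cons, h]
    simp
    omega
  · have h1 := isComposition_singleton_one.nearConcat hα
    obtain ⟨U, u, hU⟩ := List.eq_nil_or_concat' _ |>.resolve_left h1.1
    have hu : 0 < u := h1.2 u (by simp [hU])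
    rw [pad, hU, nearConcat_append_singleton_cons]
    simp [List.getLastD_eq_getLast?]
    omega

/-- The weight bound satisfied by padded compositions: first and last parts exceed their minimal
value, so that no spine vertex is a leaf. -/
theorem le_getElem_pad {α : List ℕ} (hα : IsComposition α) (i : ℕ) (hi : i < (pad α).length) :
    1 + (if i = 0 then 1 else 0) + (if i + 1 = (pad α).length then 1 else 0) ≤ (pad α)[i] := by
  have h1 := isComposition_singleton_one.nearConcat hα
  have hp : ∀ (l : List ℕ), IsComposition l → ∀ i (hi : i < (nearConcat l [1]).length),
      (if i = 0 then l.headD 0 else 1) + (if i + 1 = (nearConcat l [1]).length then 1 else 0) ≤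
        (nearConcat l [1])[i] := by
    intro l hl
    obtain ⟨hne, hpos⟩ := hl
    obtain ⟨U, u, rfl⟩ := List.eq_nil_or_concat' l |>.resolve_left hne
    rw [nearConcat_append_singleton_cons]
    intro i hi
    simp only [List.length_append, List.length_cons, List.length_nil] at hi ⊢
    have hu := hpos u (by simp)
    by_cases hiU : i < U.length
    · rw [List.getElem_append_left hiU, if_neg (show ¬ i + 1 = U.length + (0 + 1) by omega)]
      split_ifs with h0
      · subst h0
        obtain ⟨a, U, rfl⟩ := List.exists_cons_of_ne_nil (List.ne_nil_of_length_pos hiU)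
        simp
      · exact hpos _ (List.mem_append_left _ (List.getElem_mem _))
    · obtain rfl : i = U.length := by omega
      rw [List.getElem_append_right le_rfl, if_pos (show U.length + 1 = U.length + (0 + 1) by omega)]
      split_ifs with h0
      · obtain rfl := List.length_eq_zero_iff.1 h0
        simp
      · simp; omega
  have h2 : (if i = 0 then (nearConcat [1] α).headD 0 else 1) +
      (if i + 1 = (pad α).length then 1 else 0) ≤ (pad α)[i] := hp _ h1 i hi
  have h3 : 2 ≤ (nearConcat [1] α).headD 0 := by
    obtain ⟨a, l, rfl⟩ := List.exists_cons_of_ne_nil hα.1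
    have := hα.2 a (by simp)
    rw [nearConcat_singleton_cons]
    simp
    omega
  split_ifs at h2 ⊢ <;> omega

/-! ### The half-generalized degree polynomial of a padded caterpillar -/

section

variable {R : Type*} [CommRing R] (y z : R)

theorem initialSum_add_cons (n : ℕ) {b : ℕ} (hb : 0 < b) (m : List ℕ) :
    initialSum y z ((n + b) :: m) = (y + z) ^ n * initialSum y z (b :: m) := by
  cases m with
  | nil => rw [initialSum, initialSum, Nat.add_sub_assoc hb, pow_add]
  | cons c m => rw [initialSum, initialSum, Nat.add_sub_assoc hb, pow_add, mul_assoc]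

/-- A spine interval covering m parts of total n has n - m + e leaves, where e counts the ends of
the spine it reaches; its m - 1 inner edges give z and its 2 - e outer ones y. The remaining ℓ - 1 -
(m-1) - (2-e) cuts are free and give y+z each. Comparing with the factor (y+z)^{ℓ-1} leaves
(y+z)^{n+1} for the block. -/
theorem coarseSum_eq_initialSum_pad (a : ℕ) (l : List ℕ) (h : IsComposition (a :: l)) :
    coarseSum y z (fun n => (y + z) ^ (n + 1)) (a :: l) =
      (y + z) ^ l.length * (initialSum y z (pad (a :: l)) + laterSum y z (pad (a :: l)).tail) := by
  induction l generalizing a with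
  | nil =>
    rw [coarseSum_singleton, pad_cons, nearConcat_singleton_cons]
    simp [initialSum, laterSum, add_comm]
  | cons b l ih =>
    have hb := h.2 b (by simp)
    have ha := h.2 a (by simp)
    obtain ⟨c, m, hc, hm⟩ := exists_nearConcat_one b l
    have hm0 := hm 0
    rw [zero_add, zero_add] at hm0
    rw [coarseSum_cons_cons, ih b h.tail, ih (a + b) h.merge, pad_cons, pad_cons, pad_cons, hm,
      ← add_assoc, hm, nearConcat_cons_cons, hm0, List.tail_cons, List.tail_cons, List.tail_cons,
      initialSum_add_cons y z _ (by omega), initialSum_add_cons y z _ (by omega), initialSum,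
      laterSum, List.length_cons, Nat.add_sub_cancel_left]
    ring

end

theorem SwitchFactors.hdp_eq {fs gs : List (List ℕ)} (h : SwitchFactors fs gs)
    (hfs : ∀ f ∈ fs, IsComposition f) :
    hdp (Cat (pad (circProd gs))) = hdp (Cat (pad (circProd fs))) := by
  have hF := isComposition_circProd hfs
  have hG := isComposition_circProd (h.isComposition hfs)
  rw [hdp_cat hF.pad, hdp_cat hG.pad, sum_pad hF.1, sum_pad hG.1, length_pad hF.1,
    length_pad hG.1, h.sum_eq hfs, h.length_eq hfs]
  congr 1
  have hlen := h.length_eq hfs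
  have key := h.coarseSum_eq (y := (MvPolynomial.X 0 : MvPolynomial (Fin 2) ℤ))
    (z := MvPolynomial.X 1) (MvPolynomial.X_ne_zero 0)
    (fun n => (MvPolynomial.X 0 + MvPolynomial.X 1) ^ (n + 1)) hfs
  obtain ⟨a, l, hl⟩ := List.exists_cons_of_ne_nil hF.1
  obtain ⟨b, m, hm⟩ := List.exists_cons_of_ne_nil hG.1
  rw [hl] at hF
  rw [hm] at hG
  rw [hl, hm] at key hlen ⊢
  rw [coarseSum_eq_initialSum_pad _ _ _ _ hF, coarseSum_eq_initialSum_pad _ _ _ _ hG,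
    show m.length = l.length by simpa using hlen] at key
  refine mul_left_cancel₀ (pow_ne_zero _ ?_) key
  intro h0
  have := congrArg (MvPolynomial.eval fun _ => (1 : ℤ)) h0
  simp at this

/-! ### Isomorphisms of caterpillars -/

section Iso

variable {σ τ : List ℕ}

theorem ncard_neighborSet_leaf (hσ : ∀ a ∈ σ, 0 < a) {v : CatVertex σ} (hv : (v.2 : ℕ) ≠ 0) :
    ((Cat σ).neighborSet v).ncard = 1 := by
  rw [Set.ncard_eq_one]
  refine ⟨catSpine hσ v.1, Set.ext fun w => ⟨fun h => ?_, ?_⟩⟩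
  · have := cat_adj.1 ((SimpleGraph.mem_neighborSet _ _ _).1 h)
    exact CatVertex.ext (by rw [catSpine_fst]; omega) (by rw [catSpine_snd]; omega)
  · rintro rfl
    exact cat_adj.2 (.inr ⟨rfl, .inr ⟨hv, rfl⟩⟩)

theorem ncard_neighborSet_spine (hσ : ∀ a ∈ σ, 0 < a) (i : Fin σ.length) :
    ((Cat σ).neighborSet (catSpine hσ i)).ncard = (σ.get i - 1) +
      ((if (i : ℕ) = 0 then 0 else 1) + if (i : ℕ) + 1 < σ.length then 1 else 0) := by
  have h1 := card_outer_spineSeg_union hσ (le_refl (i : ℕ)) i.2 (B := ∅) (by simp)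
  rw [Finset.card_empty, Nat.sub_zero, card_leafSeg i.2, Finset.union_empty] at h1
  have h2 : spineSeg σ i i = {catSpine hσ i} := by
    ext v
    rw [mem_spineSeg, Finset.mem_singleton]
    constructor
    · rintro ⟨h0, h1, h2⟩
      exact CatVertex.ext (by rw [catSpine_fst]; omega) h0
    · rintro rfl
      exact ⟨rfl, le_rfl, le_rfl⟩
  have h3 : (Cat σ).neighborSet (catSpine hσ i) = outer (Cat σ) (spineSeg σ i i) := by
    ext v
    simp only [h2, SimpleGraph.mem_neighborSet, Finset.mem_coe, mem_outer, Finset.mem_singleton,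
      exists_eq_left]
    exact ⟨fun h => ⟨h.ne', h.symm⟩, fun h => h.2.symm⟩
  rw [h3, Set.ncard_coe_finset, h1]
  simp

/-- The bound on the parts says precisely that each spine vertex has degree at least 2, so deleting
the leaves leaves exactly the spine. -/
theorem isCaterpillar_cat (hσ : IsComposition σ)
    (hfat : ∀ i (hi : i < σ.length),
      1 + (if i = 0 then 1 else 0) + (if i + 1 = σ.length then 1 else 0) ≤ σ[i]) :
    IsCaterpillar (Cat σ) := by
  have hdeg : ∀ v : CatVertex σ, ((Cat σ).neighborSet v).ncard ≠ 1 ↔ (v.2 : ℕ) = 0 := by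
    intro v
    constructor
    · intro h
      by_contra h0
      exact h (ncard_neighborSet_leaf hσ.2 h0)
    · intro h0
      rw [eq_catSpine hσ.2 h0, ncard_neighborSet_spine]
      have := hfat v.1 v.1.2
      rw [List.get_eq_getElem]
      have := v.1.2
      split_ifs at * <;> omega
  refine ⟨isTree_cat hσ, σ.length, ⟨⟨⟨fun v => v.1.1,
    fun i => ⟨catSpine hσ.2 i, (hdeg _).2 rfl⟩, ?_, fun i => rfl⟩, ?_⟩⟩⟩
  · rintro ⟨v, hv⟩
    exact Subtype.ext (eq_catSpine hσ.2 ((hdeg v).1 hv)).symm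
  · rintro ⟨v, hv⟩ ⟨w, hw⟩
    have hv0 := (hdeg v).1 hv
    have hw0 := (hdeg w).1 hw
    rw [SimpleGraph.pathGraph_adj]
    change ((v.1 : ℕ) + 1 = w.1 ∨ (w.1 : ℕ) + 1 = v.1) ↔ (Cat σ).Adj v w
    rw [cat_adj]
    omega

/-- By injectivity, a walk with steps ±1 cannot turn back, so the first step decides the direction;
filling all of [0, k) fixes the starting point. -/
theorem eq_or_rev_of_step {k : ℕ} (f : ℕ → ℕ) (hlt : ∀ i < k, f i < k)
    (hinj : ∀ i < k, ∀ j < k, f i = f j → i = j)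
    (hstep : ∀ i, i + 1 < k → f i + 1 = f (i + 1) ∨ f (i + 1) + 1 = f i) :
    (∀ i < k, f i = i) ∨ ∀ i < k, f i = k - 1 - i := by
  rcases Nat.lt_or_ge k 2 with hk | hk
  · left
    intro i hi
    have := hlt i hi
    omega
  · have h0 := hlt 0 (by omega)
    rcases hstep 0 (by omega) with h1 | h1
    · have key : ∀ i, i + 1 < k → f i = f 0 + i ∧ f (i + 1) = f 0 + i + 1 := by
        intro i
        induction i with
        | zero => intro _; exact ⟨rfl, by omega⟩
        | succ i ih =>
          intro hi
          obtain ⟨h2, h3⟩ := ih (by omega)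
          have h4 := hstep (i + 1) hi
          have h5 : f (i + 1 + 1) ≠ f i := fun h => by
            have := hinj _ hi _ (by omega) h
            omega
          omega
      have hlast := (key (k - 2) (by omega)).2
      have hl := hlt (k - 2 + 1) (by omega)
      left
      intro i hi
      rcases Nat.eq_zero_or_pos i with rfl | hi0
      · omega
      · have := (key (i - 1) (by omega)).2
        rw [Nat.sub_add_cancel hi0] at this
        omega
    · have key : ∀ i, i + 1 < k → f i + i = f 0 ∧ f (i + 1) + i + 1 = f 0 := by
        intro i
        induction i with
        | zero => intro _; exact ⟨rfl, by omega⟩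
        | succ i ih =>
          intro hi
          obtain ⟨h2, h3⟩ := ih (by omega)
          have h4 := hstep (i + 1) hi
          have h5 : f (i + 1 + 1) ≠ f i := fun h => by
            have := hinj _ hi _ (by omega) h
            omega
          omega
      have hlast := (key (k - 2) (by omega)).2
      right
      intro i hi
      rcases Nat.eq_zero_or_pos i with rfl | hi0
      · omega
      · have := (key (i - 1) (by omega)).2
        rw [Nat.sub_add_cancel hi0] at this
        omega

theorem ncard_neighborSet_iso {V W : Type*} {G : SimpleGraph V} {H : SimpleGraph W}
    (φ : G ≃g H) (v : V) : (H.neighborSet (φ v)).ncard = (G.neighborSet v).ncard := by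
  have : H.neighborSet (φ v) = φ '' G.neighborSet v := by
    ext w
    constructor
    · intro h
      refine ⟨φ.symm w, ?_, by simp⟩
      rw [SimpleGraph.mem_neighborSet, ← φ.map_adj_iff]
      simpa using h
    · rintro ⟨u, hu, rfl⟩
      exact φ.map_adj_iff.2 hu
  rw [this, Set.ncard_image_of_injective _ φ.injective]

/-- Isomorphisms preserve degrees, so the spine, consisting of the non-leaves, goes to the spine, in
order or reversed; the degrees then determine the parts. -/
theorem eq_or_eq_reverse_of_iso (hσ : IsComposition σ) (hτ : IsComposition τ)
    (fatσ : ∀ i (hi : i < σ.length),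
      1 + (if i = 0 then 1 else 0) + (if i + 1 = σ.length then 1 else 0) ≤ σ[i])
    (fatτ : ∀ i (hi : i < τ.length),
      1 + (if i = 0 then 1 else 0) + (if i + 1 = τ.length then 1 else 0) ≤ τ[i])
    (φ : Cat σ ≃g Cat τ) : σ = τ ∨ σ = τ.reverse := by
  have spine : ∀ {σ τ : List ℕ} (hσ : IsComposition σ) (hτ : IsComposition τ)
      (fatσ : ∀ i (hi : i < σ.length),
        1 + (if i = 0 then 1 else 0) + (if i + 1 = σ.length then 1 else 0) ≤ σ[i])
      (φ : Cat σ ≃g Cat τ) (i : Fin σ.length), ((φ (catSpine hσ.2 i)).2 : ℕ) = 0 := by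
    intro σ τ hσ hτ fatσ φ i
    by_contra h0
    have h1 := ncard_neighborSet_leaf hτ.2 h0
    rw [ncard_neighborSet_iso, ncard_neighborSet_spine, List.get_eq_getElem] at h1
    have h2 := fatσ i i.2
    have h3 := i.2
    split_ifs at * <;> omega
  have hφ := spine hσ hτ fatσ φ
  have hψ := spine hτ hσ fatτ φ.symm
  let f : Fin σ.length → Fin τ.length := fun i => (φ (catSpine hσ.2 i)).1
  have hf : ∀ i, φ (catSpine hσ.2 i) = catSpine hτ.2 (f i) := fun i => eq_catSpine hτ.2 (hφ i)
  have hinj : Function.Injective f := by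
    intro i j hij
    have : φ (catSpine hσ.2 i) = φ (catSpine hσ.2 j) := by rw [hf, hf, hij]
    exact congrArg Sigma.fst (φ.injective this)
  have hsurj : Function.Surjective f := by
    intro j
    refine ⟨(φ.symm (catSpine hτ.2 j)).1, ?_⟩
    have h1 := eq_catSpine hσ.2 (hψ j)
    simp only [f]
    rw [← h1, RelIso.apply_symm_apply, catSpine_fst]
  have hlen : σ.length = τ.length := by
    simpa using Fintype.card_of_bijective (f := f) ⟨hinj, hsurj⟩
  have hval : ∀ i : Fin σ.length, σ.get i - 1 +
      ((if (i : ℕ) = 0 then 0 else 1) + if (i : ℕ) + 1 < σ.length then 1 else 0) =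
        τ.get (f i) - 1 +
      ((if (f i : ℕ) = 0 then 0 else 1) + if (f i : ℕ) + 1 < τ.length then 1 else 0) := by
    intro i
    rw [← ncard_neighborSet_spine hσ.2, ← ncard_neighborSet_spine hτ.2, ← hf,
      ncard_neighborSet_iso]
  let g : ℕ → ℕ := fun i => if h : i < σ.length then f ⟨i, h⟩ else 0
  have hg : ∀ i (h : i < σ.length), g i = f ⟨i, h⟩ := fun i h => dif_pos h
  have hcases := eq_or_rev_of_step (k := σ.length) g
    (fun i hi => by rw [hg i hi]; exact (f _).2.trans_eq hlen.symm)
    (fun i hi j hj hij => by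
      rw [hg i hi, hg j hj] at hij
      exact congrArg Fin.val (hinj (Fin.ext hij)))
    (fun i hi => by
      rw [hg i (by omega), hg (i + 1) hi]
      have : (Cat τ).Adj (catSpine hτ.2 (f ⟨i, by omega⟩)) (catSpine hτ.2 (f ⟨i + 1, hi⟩)) := by
        rw [← hf, ← hf, φ.map_adj_iff]
        exact cat_adj.2 (.inl ⟨rfl, rfl, .inl rfl⟩)
      have := cat_adj.1 this
      simp only [catSpine_fst, catSpine_snd] at this
      omega)
  have hpos : ∀ {σ : List ℕ}, IsComposition σ → ∀ i (h : i < σ.length), 0 < σ[i] :=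
    fun hσ i h => hσ.2 _ (List.getElem_mem h)
  rcases hcases with hid | hrev
  · left
    refine List.ext_getElem hlen fun i h1 h2 => ?_
    have hv := hval ⟨i, h1⟩
    have e : f ⟨i, h1⟩ = ⟨i, h2⟩ := Fin.ext ((hg i h1).symm.trans (hid i h1))
    rw [e] at hv
    simp only [List.get_eq_getElem, hlen] at hv
    have := hpos hσ i h1
    have := hpos hτ i h2
    omega
  · right
    refine List.ext_getElem (by simpa using hlen) fun i h1 h2 => ?_
    have hv := hval ⟨i, h1⟩
    have e : f ⟨i, h1⟩ = ⟨τ.length - 1 - i, by omega⟩ := Fin.ext <| by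
      rw [← hg i h1, hrev i h1, hlen]
    rw [e] at hv
    simp only [List.get_eq_getElem, hlen] at hv
    rw [List.getElem_reverse]
    have := hpos hσ i h1
    have := hpos hτ (τ.length - 1 - i) (by omega)
    split_ifs at hv <;> omega

theorem eq_or_eq_reverse_of_iso_pad {α β : List ℕ} (hα : IsComposition α)
    (hβ : IsComposition β) (φ : Cat (pad α) ≃g Cat (pad β)) : α = β ∨ α = β.reverse := by
  rcases eq_or_eq_reverse_of_iso hα.pad hβ.pad (le_getElem_pad hα) (le_getElem_pad hβ) φ with
    h | h
  · exact .inl (pad_injective hα.1 hβ.1 h)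
  · rw [← pad_reverse hβ.1] at h
    exact .inr (pad_injective hα.1 hβ.reverse.1 h)

end Iso

/-- Reversing factors in a factorization with `q` non-palindromic factors gives `2 ^ (q - 1)`
compositions, no two of which are reverses of each other. -/
theorem exists_inequivalent_switches {fs : List (List ℕ)} (hfs : ∀ f ∈ fs, IsComposition f) :
    ∃ F : Finset (List ℕ), circProd fs ∈ F ∧ 2 ^ (numNonPalindromes fs - 1) ≤ F.card ∧
      (∀ β ∈ F, IsComposition β ∧ genH β = genH (circProd fs) ∧
        IsCaterpillar (Cat (pad β)) ∧
        hdp (Cat (pad β)) = hdp (Cat (pad (circProd fs))) ∧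
        stp (Cat (pad β)) = stp (Cat (pad (circProd fs)))) ∧
      (∀ β ∈ F, ∀ γ ∈ F, β ≠ γ →
        β ≠ γ.reverse ∧ ¬ Nonempty (Cat (pad β) ≃g Cat (pad γ))) := by
  have hsw : ∀ gs ∈ halfSwitchings fs, SwitchFactors fs gs := fun gs hgs =>
    switchFactors_of_mem_switchings (halfSwitchings_subset fs hgs)
  have hinj : Set.InjOn circProd (halfSwitchings fs : Set (List (List ℕ))) :=
    fun gs hgs hs hhs h => circProd_switch_injective hfs (hsw gs hgs) (hsw hs hhs) h
  have hcomp := isComposition_circProd hfs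
  refine ⟨(halfSwitchings fs).image circProd,
    Finset.mem_image_of_mem _ (self_mem_halfSwitchings fs), ?_, ?_, ?_⟩
  · rw [Finset.card_image_of_injOn hinj]
    exact le_card_halfSwitchings fs
  · intro β hβ
    obtain ⟨gs, hgs, rfl⟩ := Finset.mem_image.1 hβ
    have h := hsw gs hgs
    have hG := isComposition_circProd (h.isComposition hfs)
    have hh := h.hdp_eq hfs
    exact ⟨hG, h.genH_eq hfs, isCaterpillar_cat hG.pad (le_getElem_pad hG), hh,
      stp_eq_of_hdp_eq (isTree_cat hG.pad).isAcyclic (isTree_cat hcomp.pad).isAcyclic hh⟩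
  · intro β hβ γ hγ hne
    obtain ⟨gs, hgs, rfl⟩ := Finset.mem_image.1 hβ
    obtain ⟨hs, hhs, rfl⟩ := Finset.mem_image.1 hγ
    have hG := (hsw gs hgs).isComposition hfs
    have hH := (hsw hs hhs).isComposition hfs
    -- The reversed product is the product of the reversed factors, again a switching of `fs`;
    -- injectivity turns the question into one about lists of factors.
    have hrev : circProd gs ≠ (circProd hs).reverse := by
      intro h
      rw [← circProd_map_reverse hH] at h
      have hh : SwitchFactors fs (hs.map List.reverse) := by
        refine List.forall₂_map_right_iff.2 ((hsw hs hhs).imp fun f g hfg => ?_)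
        rcases hfg with rfl | rfl
        exacts [.inr rfl, .inl (List.reverse_reverse f)]
      exact hne (congrArg circProd (eq_of_eq_map_reverse hgs hhs
        (circProd_switch_injective hfs (hsw gs hgs) hh h)))
    refine ⟨hrev, fun ⟨φ⟩ => ?_⟩
    rcases eq_or_eq_reverse_of_iso_pad (isComposition_circProd hG)
      (isComposition_circProd hH) φ with h | h
    exacts [hne h, hrev h]

end HalfGDP

/-! ### The three claims -/

theorem theorem6p3 :
    -- switching preserves `H`, and hence the HDP of the associated caterpillar
    (∀ α β : List ℕ, IsComposition α → IsSwitch α β →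
      genH α = genH β ∧ hdp (Cat (pad α)) = hdp (Cat (pad β))) ∧
    -- `q` non-palindromic irreducible factors yield `2 ^ (q - 1)` inequivalent compositions
    (∀ (α : List ℕ) (fs : List (List ℕ)), IsComposition α → IsIrreducibleFactorization fs α →
      ∃ F : Finset (List ℕ), α ∈ F ∧ 2 ^ (numNonPalindromes fs - 1) ≤ F.card ∧
        (∀ β ∈ F, IsComposition β ∧ genH β = genH α ∧
          IsCaterpillar (Cat (pad β)) ∧
          hdp (Cat (pad β)) = hdp (Cat (pad α)) ∧
          stp (Cat (pad β)) = stp (Cat (pad α))) ∧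
        (∀ β ∈ F, ∀ γ ∈ F, β ≠ γ →
          β ≠ γ.reverse ∧ ¬ Nonempty (Cat (pad β) ≃g Cat (pad γ)))) ∧
    -- arbitrarily large sets of non-isomorphic caterpillars with the same HDP and STP
    (∀ N : ℕ, ∃ F : Finset (List ℕ), N ≤ F.card ∧
        (∀ σ ∈ F, IsSignature σ ∧ IsCaterpillar (Cat σ)) ∧
        (∀ σ ∈ F, ∀ τ ∈ F, hdp (Cat σ) = hdp (Cat τ) ∧ stp (Cat σ) = stp (Cat τ)) ∧
        (∀ σ ∈ F, ∀ τ ∈ F, σ ≠ τ → ¬ Nonempty (Cat σ ≃g Cat τ))) := by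
  refine ⟨?_, ?_, ?_⟩
  · rintro α β - ⟨fs, gs, hfs, hsw, rfl⟩
    obtain ⟨⟨hcomp, rfl⟩, -⟩ := hfs
    have hsw : SwitchFactors fs gs := hsw
    exact ⟨(hsw.genH_eq hcomp).symm, (hsw.hdp_eq hcomp).symm⟩
  · rintro α fs - ⟨⟨hcomp, rfl⟩, -⟩
    exact exists_inequivalent_switches hcomp
  · intro N
    -- The composition (1, 2) is not a palindrome, so N + 1 copies give at least 2^N ≥ N
    -- inequivalent compositions.
    have hcomp : ∀ f ∈ List.replicate (N + 1) [1, 2], IsComposition f := by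
      intro f hf
      rw [List.eq_of_mem_replicate hf]
      exact ⟨by simp, by simp⟩
    obtain ⟨F, -, hcard, hF, hne⟩ := exists_inequivalent_switches hcomp
    have hinj : Set.InjOn pad (F : Set (List ℕ)) := fun α hα β hβ h =>
      pad_injective (hF α hα).1.1 (hF β hβ).1.1 h
    refine ⟨F.image pad, ?_, ?_, ?_, ?_⟩
    · rw [Finset.card_image_of_injOn hinj]
      refine le_trans ?_ hcard
      have : numNonPalindromes (List.replicate (N + 1) [1, 2]) = N + 1 := by
        simp [numNonPalindromes, List.countP_replicate]
      rw [this, Nat.add_sub_cancel]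
      exact Nat.lt_two_pow_self.le
    · intro σ hσ
      obtain ⟨α, hα, rfl⟩ := Finset.mem_image.1 hσ
      exact ⟨isSignature_pad (hF α hα).1, (hF α hα).2.2.1⟩
    · intro σ hσ τ hτ
      obtain ⟨α, hα, rfl⟩ := Finset.mem_image.1 hσ
      obtain ⟨β, hβ, rfl⟩ := Finset.mem_image.1 hτ
      exact ⟨(hF α hα).2.2.2.1.trans (hF β hβ).2.2.2.1.symm,
        (hF α hα).2.2.2.2.trans (hF β hβ).2.2.2.2.symm⟩
    · intro σ hσ τ hτ hστ
      obtain ⟨α, hα, rfl⟩ := Finset.mem_image.1 hσ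
      obtain ⟨β, hβ, rfl⟩ := Finset.mem_image.1 hτ
      exact (hne α hα β hβ fun h => hστ (by rw [h])).2
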